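/- Let $m\ge 2$, $b\ge 2$ and $d\ge 2b-1$ be integers. For $\mathbb K=\mathbb R$ or $\mathbb C$ and a nonzero form $f\in\mathbb K[x_0,\dots,x_m]_d$, the rank $r_{\mathbb K}(f)$ is the least $s$ such that $f=c_1\ell_1^d+\cdots+c_s\ell_s^d$ with $c_i\in\mathbb K$ and linear forms $\ell_i\in\mathbb K[x_0,\dots,x_m]_1$. Let $\sigma_b(X_{m,d}(\mathbb C))\subset\mathbb P(\mathbb C[x_0,\dots,x_m]_d)$ be the $b$-th secant variety of the degree $d$ Veronese variety, i.e. the closure of the set of classes of nonzero forms of the form $c_1\ell_1^d+\cdots+c_b\ell_b^d$ with $c_i\in\mathbb C$ and complex linear forms $\ell_i$, let $\alpha$ be its dimension, and let $\sigma_b(X_{m,d}(\mathbb C))(\mathbb R)$ be the set of its real points, i.e. of classes of nonzero real forms, with the Euclidean topology. Call a nonempty connected open subset of $\sigma_b(X_{m,d}(\mathbb C))(\mathbb R)$ which is an embedded smooth real manifold of dimension $\alpha$ a full-dimensional piece. A typical rank of $\sigma_b(X_{m,d}(\mathbb C))(\mathbb R)$ is an integer $g$ such that $r_{\mathbb R}$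 is constant and equal to $g$ on some full-dimensional piece. Theorem. The two smallest typical ranks of $\sigma_b(X_{m,d}(\mathbb C))(\mathbb R)$ are $b$ and $b+d-2$: the integer $b$ is the least typical rank, and $b+d-2$ is the least typical rank greater than $b$. Moreover there is a full-dimensional piece on which every real form $f$ has real rank $b+d-2$ and can be written as $$f=c\,\ell^d+\overline{c}\,\overline{\ell}^{\,d}+\sum_{i=1}^{b-2} r_i\,\ell_i^d ,$$ where $c\in\mathbb C\setminus\{0\}$, $\ell$ is a complex linear form not proportional to its conjugate $\overline\ell$, $r_i\in\mathbb R\setminus\{0\}$, and $\ell_1,\dots,\ell_{b-2}$ are nonzero, pairwise non-proportional real linear forms. -/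

import Mathlib

namespace RealTypicalRank

noncomputable section

open scoped ContDiff

/-- The exponents of the monomials of degree `d` in the variables `x_0, …, x_m`. -/
abbrev Exps (m d : ℕ) : Type :=
  ↥(Finset.finsuppAntidiag (Finset.univ : Finset (Fin (m + 1))) d)

/-- Forms of degree `d` in `x_0, …, x_m` over `K`, given by their coefficients. For `K = ℝ` or
`K = ℂ` this is a finite-dimensional vector space with its Euclidean topology. -/
abbrev Form (K : Type) (m d : ℕ) : Type := Exps m d → K

/-- The homogeneous polynomial with the given coefficients. -/
def poly {K : Type} [CommSemiring K] {m d : ℕ} (f : Form K m d) :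
    MvPolynomial (Fin (m + 1)) K :=
  ∑ e : Exps m d, MvPolynomial.monomial (e : Fin (m + 1) →₀ ℕ) (f e)

/-- The linear form `a_0 x_0 + ⋯ + a_m x_m`. -/
def linForm {K : Type} [CommSemiring K] {m : ℕ} (a : Fin (m + 1) → K) :
    MvPolynomial (Fin (m + 1)) K :=
  ∑ i, MvPolynomial.C (a i) * MvPolynomial.X i

/-- `f = c_1 ℓ_1 ^ d + ⋯ + c_s ℓ_s ^ d` with `c_i ∈ K` and linear forms `ℓ_i` over `K`. -/
def IsSumOfPowers {K : Type} [CommSemiring K] {m d : ℕ} (s : ℕ) (f : Form K m d) : Prop :=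
  ∃ (c : Fin s → K) (a : Fin s → Fin (m + 1) → K),
    poly f = ∑ i, MvPolynomial.C (c i) * linForm (a i) ^ d

/-- The symmetric tensor rank of the form `f` over `K` is `s`. -/
def HasRank {K : Type} [CommSemiring K] {m d : ℕ} (f : Form K m d) (s : ℕ) : Prop :=
  IsLeast {t : ℕ | IsSumOfPowers t f} s

/-- The affine cone over the `b`-th secant variety of the complex Veronese variety: the closure
of the set of the complex forms that are combinations of `b` powers of linear forms. -/
def secantCone (m d b : ℕ) : Set (Form ℂ m d) :=
  closure {f | IsSumOfPowers b f}

/-- The real points of the secant variety: the nonzero real forms that lie in the complex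
secant cone. -/
def realSecant (m d b : ℕ) : Set (Form ℝ m d) :=
  {f | f ≠ 0 ∧ (fun e => (f e : ℂ)) ∈ secantCone m d b}

/-- The dimension of the affine cone over the complex secant variety (one more than the dimension
of the projective variety), as the Krull dimension of its coordinate ring. -/
def coneDim (m d b : ℕ) : WithBot ℕ∞ :=
  ringKrullDim (MvPolynomial (Exps m d) ℂ ⧸
    MvPolynomial.vanishingIdeal ℂ (secantCone m d b))

/-- `M` is an embedded smooth submanifold of dimension `n` of the normed space `E`: around each of
its points it has a local parametrization by an open subset of `ℝⁿ`. -/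
def IsSubmanifold {E : Type} [NormedAddCommGroup E] [NormedSpace ℝ E] (n : ℕ) (M : Set E) :
    Prop :=
  ∀ x ∈ M, ∃ (W : Set (EuclideanSpace ℝ (Fin n))) (φ : EuclideanSpace ℝ (Fin n) → E),
    IsOpen W ∧ ContDiffOn ℝ ∞ φ W ∧
    (∀ w ∈ W, Function.Injective (fderiv ℝ φ w)) ∧
    Topology.IsEmbedding (fun w : W => φ w) ∧
    x ∈ φ '' W ∧ ∃ O : Set E, IsOpen O ∧ φ '' W = M ∩ O

/-- `U` is a nonempty connected open part of the real points of the secant variety which is a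
manifold of full dimension, the dimension of the complex secant variety. (Everything is taken in
the affine cone without its vertex, which raises both dimensions by one.) -/
def IsTopPiece (m d b : ℕ) (U : Set (Form ℝ m d)) : Prop :=
  IsConnected U ∧ (∃ O : Set (Form ℝ m d), IsOpen O ∧ U = realSecant m d b ∩ O) ∧
  ∃ n : ℕ, coneDim m d b = n ∧ IsSubmanifold n U

/-- `g` is a typical rank of the real points of the `b`-th secant variety: the real rank is
constant and equal to `g` on some open part of full dimension. -/
def IsTypicalRank (m d b g : ℕ) : Prop :=
  ∃ U : Set (Form ℝ m d), IsTopPiece m d b U ∧ ∀ f ∈ U, HasRank f g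

/-- `f` is a combination, with nonzero coefficients, of the `d`-th powers of linear forms that
represent `s + 2` distinct points of the complex projective space, namely one pair of distinct
conjugate points and `s` real points. -/
def HasOnePairDecomposition {m d : ℕ} (s : ℕ) (f : Form ℝ m d) : Prop :=
  ∃ (c : ℂ) (q : Fin (m + 1) → ℂ) (r : Fin s → ℝ) (p : Fin s → Fin (m + 1) → ℝ),
    c ≠ 0 ∧ LinearIndependent ℂ ![q, star q] ∧
    (∀ i, r i ≠ 0) ∧ (∀ i, p i ≠ 0) ∧
    (∀ i j, i ≠ j → LinearIndependent ℝ ![p i, p j]) ∧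
    MvPolynomial.map Complex.ofRealHom (poly f) =
      MvPolynomial.C c * linForm q ^ d + MvPolynomial.C (star c) * linForm (star q) ^ d +
        ∑ i, MvPolynomial.C (r i : ℂ) * linForm (fun k => (p i k : ℂ)) ^ d

end

end RealTypicalRank

/-! ### Krull dimension, and Zariski density of full-dimensional real manifolds. -/

namespace RealTypicalRank

open Filter Topology
open scoped ContDiff

/-! The secant cone has a rational chart defined over ℝ. Row 0 of a parameter `w` holds the initial
values of a linear recurrence of order `b`, row 1 its coefficients, and the other rows polynomials
`h_k` of degree below `b`. If the characteristic polynomial `recPoly w` has distinct roots `t_i`,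
then `curveForm d w` is a combination of the `d`-th powers of the linear forms with coefficients
`(1, t_i, h_2(t_i), …)`. Where the Hankel matrix of the moments in `x_0, x_1` is nonsingular, `w` is
recovered rationally by `chartCoord`; this reads the moments up to index `2b - 1`, hence `2b - 1 ≤
d`. By continuity and conjugation invariance every real point there comes from a real `w`
(`exists_curveForm_eq_of_mem_realSecant`). Real roots are then real summands, and non-real roots
come in conjugate pairs.

A full-dimensional piece is Zariski dense, so it contains the image of an open set of parameters
(`IsTopPiece.exists_isOpen`). A nonsingular Hankel matrix forces rank at least `b`, and distinct
real roots give rank `b`.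

Suppose there is a non-real root and that the points, projected to the first three coordinates, have
no three collinear. Then any real decomposition has at least `b + d - 2` terms
(`le_card_of_relation`): with fewer, a product of `d` linear forms vanishes at all points of both
decompositions but one, which contradicts their equality. Both distinct roots and non-collinearity
can be reached by small perturbations. Hence a typical rank above `b` is at least `b + d - 2`.

Conversely, a conjugate pair of powers is a sum of `d` real ones (`sum_pow_eq_add_conj_pow`), so one
pair and `b - 2` real roots give at most `d + b - 2` terms. Near a suitable parameter exactly this
configuration persists, which yields the required piece. -/

theorem ringKrullDim_eq_of_isIntegral {R S : Type} [CommRing R] [CommRing S] [IsDomain S]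
    [Algebra R S] [Algebra.IsIntegral R S] (hinj : Function.Injective (algebraMap R S)) :
    ringKrullDim S = ringKrullDim R := by
  apply le_antisymm
  · exact Order.krullDim_le_of_strictMono (PrimeSpectrum.comap (algebraMap R S))
      fun I J h => Ideal.IsIntegral.comap_lt_comap (I := I.asIdeal) (J := J.asIdeal) h
  · refine iSup_le fun l => ?_
    obtain ⟨Q, hQ, hQl⟩ := Ideal.exists_ideal_over_prime_of_isIntegral_of_isDomain (S := S)
      (RelSeries.head l).asIdeal (by
        rw [(RingHom.injective_iff_ker_eq_bot _).1 hinj]; exact bot_le)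
    have : Q.LiesOver (RelSeries.head l).asIdeal := ⟨hQl.symm⟩
    obtain ⟨L, hL, -⟩ := Ideal.exists_ltSeries_of_hasGoingUp l Q
    rw [← hL]
    exact Order.LTSeries.length_le_krullDim L

/-- By Noether normalization, `A` is integral over a polynomial subring, which has the same Krull
dimension and the same transcendence degree. -/
theorem ringKrullDim_eq_trdeg {k A : Type} [Field k] [CommRing A] [IsDomain A] [Algebra k A]
    [Algebra.FiniteType k A] {n : ℕ} (h : Algebra.trdeg k A = n) : ringKrullDim A = n := by
  obtain ⟨s, g, hg, hfin⟩ := exists_integral_inj_algHom_of_fg k A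
  let _ := g.toRingHom.toAlgebra
  have : Algebra.IsIntegral (MvPolynomial (Fin s) k) A := ⟨hfin⟩
  have : IsScalarTower k (MvPolynomial (Fin s) k) A :=
    IsScalarTower.of_algebraMap_eq fun x => (g.commutes x).symm
  have hinj : Function.Injective (algebraMap (MvPolynomial (Fin s) k) A) := hg
  have : FaithfulSMul (MvPolynomial (Fin s) k) A := (faithfulSMul_iff_algebraMap_injective _ _).2 hinj
  have h1 := _root_.trdeg_add_eq k (MvPolynomial (Fin s) k) (A := A)
  rw [_root_.trdeg_eq_zero (R := MvPolynomial (Fin s) k), MvPolynomial.trdeg_of_isDomain, h] at h1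
  have h2 : s = n := by simpa using h1
  rw [ringKrullDim_eq_of_isIntegral hinj, MvPolynomial.ringKrullDim_of_isNoetherianRing]
  simp [h2]

/-- For `T` a left inverse of the derivative of a local parametrization, the composite has
derivative the identity and is open at the point. Linearity of `T` keeps its components polynomial.
-/
theorem IsSubmanifold.exists_image_mem_nhds {E : Type} [NormedAddCommGroup E] [NormedSpace ℝ E]
    [FiniteDimensional ℝ E] {n : ℕ} {M : Set E} (hM : IsSubmanifold n M) {x : E} (hx : x ∈ M) :
    ∃ T : E →ₗ[ℝ] (Fin n → ℝ), T '' M ∈ 𝓝 (T x) := by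
  obtain ⟨W, φ, hW, hφ, hD, -, ⟨w, hw, rfl⟩, O, -, hO⟩ := hM x hx
  obtain ⟨g, hg⟩ := (fderiv ℝ φ w).toLinearMap.exists_leftInverse_of_injective
    (LinearMap.ker_eq_bot.2 (hD w hw))
  have h1 : HasStrictFDerivAt φ (fderiv ℝ φ w) w :=
    (hφ.contDiffAt (hW.mem_nhds hw)).hasStrictFDerivAt (by simp)
  let T : E →ₗ[ℝ] (Fin n → ℝ) := (EuclideanSpace.equiv (Fin n) ℝ).toLinearMap ∘ₗ g
  have h2 : HasStrictFDerivAt (fun v => T.toContinuousLinearMap (φ v))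
      (T.toContinuousLinearMap.comp (fderiv ℝ φ w)) w :=
    (T.toContinuousLinearMap.hasStrictFDerivAt).comp w h1
  have h3 := h2.map_nhds_eq_of_surj (by
    rw [LinearMap.range_eq_top]
    intro y
    refine ⟨(EuclideanSpace.equiv (Fin n) ℝ).symm y, ?_⟩
    have := LinearMap.congr_fun hg ((EuclideanSpace.equiv (Fin n) ℝ).symm y)
    simp only [LinearMap.comp_apply, LinearMap.id_apply] at this
    change (EuclideanSpace.equiv (Fin n) ℝ) (g (fderiv ℝ φ w _)) = y
    erw [this]
    exact (EuclideanSpace.equiv (Fin n) ℝ).apply_symm_apply y)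
  refine ⟨T, ?_⟩
  have h4 : (fun v => T.toContinuousLinearMap (φ v)) '' W ∈ 𝓝 (T (φ w)) := by
    change _ ∈ 𝓝 ((fun v => T.toContinuousLinearMap (φ v)) w)
    rw [← h3]
    exact image_mem_map (hW.mem_nhds hw)
  refine mem_of_superset h4 ?_
  rintro _ ⟨v, hv, rfl⟩
  have : φ v ∈ M ∩ O := hO ▸ ⟨v, hv, rfl⟩
  exact ⟨φ v, this.1, rfl⟩

theorem eq_zero_of_eval_eq_zero_of_mem_nhds {n : ℕ} {S : Set (Fin n → ℝ)} {x : Fin n → ℝ}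
    (hS : S ∈ 𝓝 x) {Q : MvPolynomial (Fin n) ℂ}
    (hQ : ∀ y ∈ S, MvPolynomial.eval (fun i => (y i : ℂ)) Q = 0) : Q = 0 := by
  obtain ⟨r, hr, hrS⟩ := Metric.mem_nhds_iff.1 hS
  refine MvPolynomial.funext_set (fun i => Complex.ofReal '' Metric.ball (x i) r) (fun i => ?_) ?_
  · refine Set.Infinite.image Complex.ofReal_injective.injOn ?_
    rw [Real.ball_eq_Ioo]
    exact Set.Ioo_infinite (by linarith)
  · intro z hz
    choose y hy hyz using fun i => hz i (Set.mem_univ i)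
    have : z = fun i => (y i : ℂ) := funext fun i => (hyz i).symm
    rw [this, map_zero]
    refine hQ y (hrS ?_)
    rw [ball_pi _ hr]
    exact fun i _ => hy i

section VanishingIdeal

open MvPolynomial

variable {σ : Type} [Fintype σ]

/-- The linear forms that are the components of a linear map. -/
noncomputable def coordPoly [DecidableEq σ] {n : ℕ} (T : (σ → ℝ) →ₗ[ℝ] (Fin n → ℝ)) (i : Fin n) :
    MvPolynomial σ ℂ :=
  ∑ e, C ((T (Pi.single e 1) i : ℝ) : ℂ) * X e

theorem aeval_coordPoly [DecidableEq σ] {n : ℕ} (T : (σ → ℝ) →ₗ[ℝ] (Fin n → ℝ)) (i : Fin n)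
    (f : σ → ℝ) : aeval (fun e => (f e : ℂ)) (coordPoly T i) = ((T f i : ℝ) : ℂ) := by
  have h : f = ∑ e, f e • (Pi.single e 1 : σ → ℝ) := by
    ext j
    simp [Finset.sum_apply, Pi.single_apply]
  conv_rhs => rw [h]
  simp [coordPoly, Finset.sum_apply, mul_comm]

theorem aeval_aeval_coordPoly [DecidableEq σ] {n : ℕ} (T : (σ → ℝ) →ₗ[ℝ] (Fin n → ℝ))
    (Q : MvPolynomial (Fin n) ℂ) (f : σ → ℝ) :
    aeval (fun e => (f e : ℂ)) (aeval (coordPoly T) Q) = eval (fun i => ((T f i : ℝ) : ℂ)) Q := by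
  rw [← AlgHom.comp_apply, comp_aeval, ← aeval_eq_eval]
  congr 2
  funext i
  exact aeval_coordPoly T i f

/-- An algebraic relation among the components of `T` modulo the ideal of `V` is a polynomial
vanishing on `T '' M`, which has an interior point. -/
theorem exists_algebraicIndependent_of_isSubmanifold [DecidableEq σ] {V : Set (σ → ℂ)}
    {M : Set (σ → ℝ)} (hMV : ∀ f ∈ M, (fun e => (f e : ℂ)) ∈ V) {n : ℕ} (hM : IsSubmanifold n M)
    (hne : M.Nonempty) :
    ∃ T : (σ → ℝ) →ₗ[ℝ] (Fin n → ℝ),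
      (∀ Q : MvPolynomial (Fin n) ℂ,
        (∀ f ∈ M, eval (fun i => ((T f i : ℝ) : ℂ)) Q = 0) → Q = 0) ∧
      AlgebraicIndependent ℂ
        (fun i => Ideal.Quotient.mkₐ ℂ (vanishingIdeal ℂ V) (coordPoly T i)) := by
  obtain ⟨x, hx⟩ := hne
  obtain ⟨T, hT⟩ := hM.exists_image_mem_nhds hx
  have key : ∀ Q : MvPolynomial (Fin n) ℂ,
        (∀ f ∈ M, eval (fun i => ((T f i : ℝ) : ℂ)) Q = 0) → Q = 0 := by
    intro Q hQ
    refine eq_zero_of_eval_eq_zero_of_mem_nhds hT ?_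
    rintro _ ⟨f, hf, rfl⟩
    exact hQ f hf
  refine ⟨T, key, ?_⟩
  rw [algebraicIndependent_iff]
  intro Q hQ
  refine key Q fun f hf => ?_
  rw [← aeval_aeval_coordPoly]
  have h1 : Ideal.Quotient.mkₐ ℂ (vanishingIdeal ℂ V) (aeval (coordPoly T) Q) = 0 := by
    rw [← hQ, ← AlgHom.comp_apply, comp_aeval]
  rw [Ideal.Quotient.mkₐ_eq_mk, Ideal.Quotient.eq_zero_iff_mem] at h1
  exact h1 _ (hMV f hf)

/-- A real manifold of dimension at least the transcendence degree is Zariski dense: the components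
of `T` already form a transcendence basis. -/
theorem exists_ne_zero_of_isSubmanifold {V : Set (σ → ℂ)} {M : Set (σ → ℝ)}
    (hMV : ∀ f ∈ M, (fun e => (f e : ℂ)) ∈ V) {n : ℕ} (hM : IsSubmanifold n M)
    (hne : M.Nonempty) [IsDomain (MvPolynomial σ ℂ ⧸ vanishingIdeal ℂ V)]
    (hdim : Algebra.trdeg ℂ (MvPolynomial σ ℂ ⧸ vanishingIdeal ℂ V) ≤ n)
    {P : MvPolynomial σ ℂ} (hP : P ∉ vanishingIdeal ℂ V) :
    ∃ f ∈ M, aeval (fun e => (f e : ℂ)) P ≠ 0 := by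
  classical
  by_contra! hcon
  obtain ⟨T, key, hind⟩ := exists_algebraicIndependent_of_isSubmanifold hMV hM hne
  have hbasis := hind.isTranscendenceBasis_of_trdeg_le_of_finite (by simpa using hdim)
  have := hbasis.isAlgebraic
  set A := MvPolynomial σ ℂ ⧸ vanishingIdeal ℂ V
  set π := Ideal.Quotient.mkₐ ℂ (vanishingIdeal ℂ V)
  have halg : IsAlgebraic (Algebra.adjoin ℂ (Set.range fun i => π (coordPoly T i))) (π P) :=
    Algebra.IsAlgebraic.isAlgebraic _
  have hπP : π P ≠ 0 := by
    rwa [Ne, Ideal.Quotient.mkₐ_eq_mk, Ideal.Quotient.eq_zero_iff_mem]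
  -- Some multiple of `P` is a nonzero polynomial `Q` in the components of `T`. If `P` vanished on
  -- `M`, so would `Q`, which `key` forbids.
  obtain ⟨r, hr, a, ha⟩ := halg.exists_nonzero_dvd (mem_nonZeroDivisors_of_ne_zero hπP)
  obtain ⟨r, hrm⟩ := r
  have hrm' := hrm
  rw [Algebra.adjoin_range_eq_range_aeval] at hrm'
  obtain ⟨Q, rfl⟩ := hrm'
  obtain ⟨a, rfl⟩ := Ideal.Quotient.mk_surjective a
  have h0 : Q = 0 := by
    refine key Q fun f hf => ?_
    have h1 : π (aeval (coordPoly T) Q) = π (P * a) := by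
      rw [map_mul, ← AlgHom.comp_apply, comp_aeval]
      exact ha
    rw [Ideal.Quotient.mkₐ_eq_mk, Ideal.Quotient.eq] at h1
    have h2 := h1 _ (hMV f hf)
    rw [map_sub, map_mul, hcon f hf, zero_mul, sub_zero, aeval_aeval_coordPoly] at h2
    exact h2
  apply hr
  ext
  simp [h0]

end VanishingIdeal

end RealTypicalRank

/-! ### Moments of a form and the apolarity pairing. -/

namespace RealTypicalRank

open Finset MvPolynomial

section Moments

variable {K : Type} [Field K] {m d : ℕ}

/-- The multinomial coefficient of an exponent, as a scalar. -/
noncomputable def mult (K : Type) [Field K] {m : ℕ} (e : Fin (m + 1) →₀ ℕ) : K :=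
  (Nat.multinomial univ e : ℕ)

theorem mult_ne_zero [CharZero K] (e : Fin (m + 1) →₀ ℕ) : mult K e ≠ 0 := by
  simp [mult, (Nat.multinomial_pos _ _).ne']

/-- The coefficients of the `d`-th power of a linear form. -/
noncomputable def powForm (d : ℕ) (a : Fin (m + 1) → K) : Form K m d :=
  fun e => mult K (e : Fin (m + 1) →₀ ℕ) * ∏ k, a k ^ (e : Fin (m + 1) →₀ ℕ) k

/-- The moments of a form: its coefficients divided by the multinomial coefficients. -/
noncomputable def mom (f : Form K m d) (e : Fin (m + 1) →₀ ℕ) : K :=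
  if h : e ∈ finsuppAntidiag univ d then f ⟨e, h⟩ / mult K e else 0

theorem coeff_poly {R : Type} [CommSemiring R] (f : Form R m d) (e : Fin (m + 1) →₀ ℕ) :
    coeff e (poly f) = if h : e ∈ finsuppAntidiag univ d then f ⟨e, h⟩ else 0 := by
  classical
  simp only [poly, coeff_sum, coeff_monomial]
  split_ifs with h
  · rw [Finset.sum_eq_single ⟨e, h⟩]
    · simp
    · rintro ⟨e', he'⟩ - hne
      rw [if_neg]
      rintro rfl
      exact hne rfl
    · simp
  · refine Finset.sum_eq_zero fun e' _ => ?_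
    rw [if_neg]
    rintro rfl
    exact h e'.2

theorem poly_injective {R : Type} [CommSemiring R] :
    Function.Injective (poly : Form R m d → MvPolynomial (Fin (m + 1)) R) := by
  intro f g h
  funext e
  have := congrArg (coeff (e : Fin (m + 1) →₀ ℕ)) h
  simpa [coeff_poly] using this

theorem poly_sum_smul {R ι : Type} [CommSemiring R] (s : Finset ι) (c : ι → R)
    (f : ι → Form R m d) : poly (∑ i ∈ s, c i • f i) = ∑ i ∈ s, C (c i) * poly (f i) := by
  ext e
  simp only [coeff_poly, coeff_sum, coeff_C_mul]
  split_ifs <;> simp [Finset.sum_apply]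

theorem poly_powForm (a : Fin (m + 1) → K) : poly (powForm d a) = linForm a ^ d := by
  have hl : linForm a = ((Finsupp.equivFunOnFinite.symm a).linearCombination K X :
      MvPolynomial (Fin (m + 1)) K) := by
    rw [Finsupp.linearCombination_apply, Finsupp.sum_fintype _ _ (by simp)]
    simp [linForm, smul_eq_C_mul]
  ext e
  rw [coeff_poly, hl, coeff_linearCombination_X_pow]
  have hmem : e ∈ finsuppAntidiag univ d ↔ (e.sum fun _ n => n) = d := by
    rw [mem_finsuppAntidiag, Finsupp.sum_fintype _ _ (by simp)]
    simp
  by_cases h : e ∈ finsuppAntidiag univ d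
  · rw [dif_pos h, if_pos (hmem.1 h)]
    rw [Finsupp.prod_fintype _ _ (by simp)]
    simp only [powForm, mult]
    congr 2
    rw [Finsupp.multinomial_eq]
    refine (Nat.multinomial_congr_of_sdiff (Finset.subset_univ _) ?_ ?_).symm
    · simp
    · simp
  · rw [dif_neg h, if_neg (fun h' => h (hmem.2 h'))]

theorem isSumOfPowers_iff {s : ℕ} {f : Form K m d} :
    IsSumOfPowers s f ↔
      ∃ (c : Fin s → K) (a : Fin s → Fin (m + 1) → K), f = ∑ i, c i • powForm d (a i) := by
  refine exists_congr fun c => exists_congr fun a => ?_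
  rw [← poly_injective.eq_iff, poly_sum_smul]
  simp [poly_powForm]

theorem mem_antidiag_iff {e : Fin (m + 1) →₀ ℕ} :
    e ∈ finsuppAntidiag univ d ↔ ∑ k, e k = d := by
  simp [mem_finsuppAntidiag]

theorem mom_powForm [CharZero K] (a : Fin (m + 1) → K) {e : Fin (m + 1) →₀ ℕ}
    (he : ∑ k, e k = d) : mom (powForm d a) e = ∏ k, a k ^ e k := by
  rw [mom, dif_pos (mem_antidiag_iff.2 he), powForm, mul_div_cancel_left₀ _ (mult_ne_zero e)]

theorem mom_sum_smul {ι : Type} (s : Finset ι) (c : ι → K) (f : ι → Form K m d)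
    (e : Fin (m + 1) →₀ ℕ) : mom (∑ i ∈ s, c i • f i) e = ∑ i ∈ s, c i * mom (f i) e := by
  simp only [mom]
  split_ifs
  · simp [Finset.sum_apply, Finset.sum_div, mul_div_assoc]
  · simp

/-- Each side is a linear functional of the moments of the common form. Equality of two
decompositions can thus be tested on any form `P` of degree `d`. -/
theorem sum_mul_eval_eq [CharZero K] {ι κ : Type} [Fintype ι] [Fintype κ] {c : ι → K}
    {a : ι → Fin (m + 1) → K} {c' : κ → K} {a' : κ → Fin (m + 1) → K}
    (h : ∑ i, c i • powForm d (a i) = ∑ j, c' j • powForm d (a' j))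
    {P : MvPolynomial (Fin (m + 1)) K} (hP : P.IsHomogeneous d) :
    ∑ i, c i * eval (a i) P = ∑ j, c' j * eval (a' j) P := by
  have key : ∀ {ι : Type} [Fintype ι] (c : ι → K) (a : ι → Fin (m + 1) → K),
      ∑ i, c i * eval (a i) P =
        ∑ e ∈ P.support, coeff e P * mom (∑ i, c i • powForm d (a i)) e := by
    intro ι _ c a
    simp_rw [eval_eq', mom_sum_smul, Finset.mul_sum]
    rw [Finset.sum_comm]
    refine Finset.sum_congr rfl fun e he => Finset.sum_congr rfl fun i _ => ?_
    have hd : ∑ k, e k = d := by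
      have := hP (mem_support_iff.1 he)
      rw [← this, ← Finsupp.degree_eq_sum]
      exact congrArg (fun F => F e) (Finsupp.degree_eq_weight_one (R := ℕ))
    rw [mom_powForm _ hd]
    ring
  rw [key, key, h]

end Moments

end RealTypicalRank

/-! ### The chart: linear recurrences, interpolating curves and Hankel matrices. -/

namespace RealTypicalRank

open Finset

section Chart

variable {R : Type} [CommRing R] {m b d : ℕ}

/-- The linear recurrence with initial values `w 0` and coefficients `w 1`. -/
noncomputable def recSeq (w : Fin (m + 1) → Fin b → R) : ℕ → R :=
  (LinearRecurrence.mk b (w 1)).mkSol (w 0)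

/-- The characteristic polynomial of the recurrence. -/
noncomputable def recPoly (w : Fin (m + 1) → Fin b → R) : Polynomial R :=
  (LinearRecurrence.mk b (w 1)).charPoly

/-- The linear functional on polynomials with the moments given by the recurrence. -/
noncomputable def recFun (w : Fin (m + 1) → Fin b → R) : Polynomial R →ₗ[R] R :=
  Polynomial.lsum fun n => LinearMap.mulRight R (recSeq w n)

/-- The coordinate functions of the affine curve `t ↦ (1, t, h_2(t), …)`. -/
noncomputable def curveCoord (w : Fin (m + 1) → Fin b → R) (k : Fin (m + 1)) : Polynomial R :=
  if k = 0 then 1 else if k = 1 then Polynomial.X else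
    ∑ j, Polynomial.C (w k j) * Polynomial.X ^ (j : ℕ)

theorem recSeq_of_lt (w : Fin (m + 1) → Fin b → R) (j : Fin b) : recSeq w j = w 0 j :=
  LinearRecurrence.mkSol_eq_init (LinearRecurrence.mk b (w 1)) (w 0) j

theorem recSeq_add (w : Fin (m + 1) → Fin b → R) (n : ℕ) :
    recSeq w (n + b) = ∑ j, w 1 j * recSeq w (n + j) :=
  LinearRecurrence.is_sol_mkSol (LinearRecurrence.mk b (w 1)) (w 0) n

theorem recSeq_eq_of_isSolution (w : Fin (m + 1) → Fin b → R) {u : ℕ → R}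
    (h0 : ∀ j : Fin b, u j = w 0 j) (h1 : ∀ n, u (n + b) = ∑ j, w 1 j * u (n + j)) (n : ℕ) :
    u n = recSeq w n :=
  LinearRecurrence.eq_mk_of_is_sol_of_eq_init (LinearRecurrence.mk b (w 1)) h1 h0 n

theorem recPoly_eq (w : Fin (m + 1) → Fin b → R) :
    recPoly w = Polynomial.X ^ b - ∑ j, Polynomial.C (w 1 j) * Polynomial.X ^ (j : ℕ) := by
  simp [recPoly, LinearRecurrence.charPoly,
    Polynomial.X_pow_eq_monomial]

theorem recPoly_monic (w : Fin (m + 1) → Fin b → R) : (recPoly w).Monic :=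
  LinearRecurrence.charPoly_monic _

theorem natDegree_recPoly [Nontrivial R] (w : Fin (m + 1) → Fin b → R) :
    (recPoly w).natDegree = b :=
  Polynomial.natDegree_eq_of_degree_eq_some (LinearRecurrence.charPoly_degree_eq_order _)

theorem eval_recPoly (w : Fin (m + 1) → Fin b → R) (t : R) :
    (recPoly w).eval t = t ^ b - ∑ j, w 1 j * t ^ (j : ℕ) := by
  simp [recPoly_eq, Polynomial.eval_finsetSum]

@[simp] theorem recFun_monomial (w : Fin (m + 1) → Fin b → R) (n : ℕ) (r : R) :
    recFun w (Polynomial.monomial n r) = r * recSeq w n := by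
  simp [recFun]

theorem recFun_X_pow (w : Fin (m + 1) → Fin b → R) (n : ℕ) :
    recFun w (Polynomial.X ^ n) = recSeq w n := by
  rw [Polynomial.X_pow_eq_monomial, recFun_monomial, one_mul]

theorem recFun_C_mul (w : Fin (m + 1) → Fin b → R) (r : R) (p : Polynomial R) :
    recFun w (Polynomial.C r * p) = r * recFun w p := by
  rw [← Polynomial.smul_eq_C_mul, map_smul, smul_eq_mul]

theorem recFun_eq_sum_eval {ι : Type} [Fintype ι] {w : Fin (m + 1) → Fin b → R} {c t : ι → R}
    (h : ∀ n, recSeq w n = ∑ i, c i * t i ^ n) (p : Polynomial R) :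
    recFun w p = ∑ i, c i * p.eval (t i) := by
  induction p using Polynomial.induction_on' with
  | add p q hp hq => simp [hp, hq, mul_add, Finset.sum_add_distrib]
  | monomial n r =>
    rw [recFun_monomial, h, Finset.mul_sum]
    refine Finset.sum_congr rfl fun i _ => ?_
    simp only [Polynomial.eval_monomial]
    ring

theorem recSeq_eq_sum_pow {ι : Type} [Fintype ι] {w : Fin (m + 1) → Fin b → R} {c t : ι → R}
    (ht : ∀ i, (recPoly w).eval (t i) = 0) (h0 : ∀ j : Fin b, ∑ i, c i * t i ^ (j : ℕ) = w 0 j)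
    (n : ℕ) : recSeq w n = ∑ i, c i * t i ^ n := by
  refine (recSeq_eq_of_isSolution w (u := fun n => ∑ i, c i * t i ^ n) h0 (fun n => ?_) n).symm
  simp_rw [Finset.mul_sum]
  rw [Finset.sum_comm]
  refine Finset.sum_congr rfl fun i _ => ?_
  have := ht i
  rw [eval_recPoly, sub_eq_zero] at this
  rw [pow_add, this, Finset.mul_sum, Finset.mul_sum]
  exact Finset.sum_congr rfl fun j _ => by ring

section Map

variable {S : Type} [CommRing S] (φ : R →+* S) (w : Fin (m + 1) → Fin b → R)

theorem recSeq_map (n : ℕ) : recSeq (fun k j => φ (w k j)) n = φ (recSeq w n) := by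
  refine (recSeq_eq_of_isSolution _ (u := fun n => φ (recSeq w n)) (fun j => ?_)
    (fun n => ?_) n).symm
  · simp [recSeq_of_lt]
  · simp [recSeq_add]

theorem recFun_map (p : Polynomial R) :
    recFun (fun k j => φ (w k j)) (p.map φ) = φ (recFun w p) := by
  induction p using Polynomial.induction_on' with
  | add p q hp hq => simp [hp, hq]
  | monomial n r => simp [recSeq_map]

theorem recPoly_map : recPoly (fun k j => φ (w k j)) = (recPoly w).map φ := by
  simp [recPoly_eq, Polynomial.map_sum]

theorem curveCoord_map (k : Fin (m + 1)) :
    curveCoord (fun k j => φ (w k j)) k = (curveCoord w k).map φ := by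
  unfold curveCoord
  split_ifs <;> simp [Polynomial.map_sum]

end Map

/-- The moments of the form attached to a parameter. -/
noncomputable def curveMoment (w : Fin (m + 1) → Fin b → R) (e : Fin (m + 1) →₀ ℕ) : R :=
  recFun w (∏ k, curveCoord w k ^ e k)

/-- Naturality serves three purposes: the inclusion of ℝ in ℂ, complex conjugation, and
specialization of a parameter whose entries are variables. -/
theorem curveMoment_map {S : Type} [CommRing S] (φ : R →+* S) (w : Fin (m + 1) → Fin b → R)
    (e : Fin (m + 1) →₀ ℕ) :
    curveMoment (fun k j => φ (w k j)) e = φ (curveMoment w e) := by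
  rw [curveMoment, curveMoment, ← recFun_map, Polynomial.map_prod]
  simp [curveCoord_map]

end Chart

section ChartField

variable {K : Type} [Field K] {m b d : ℕ}

/-- The form attached to a parameter. -/
noncomputable def curveForm (d : ℕ) (w : Fin (m + 1) → Fin b → K) : Form K m d :=
  fun e => mult K (e : Fin (m + 1) →₀ ℕ) * curveMoment w e

theorem mom_curveForm [CharZero K] (w : Fin (m + 1) → Fin b → K) {e : Fin (m + 1) →₀ ℕ}
    (he : ∑ k, e k = d) : mom (curveForm d w) e = curveMoment w e := by
  rw [mom, dif_pos (mem_antidiag_iff.2 he), curveForm, mul_div_cancel_left₀ _ (mult_ne_zero e)]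

theorem curveForm_eq_sum {ι : Type} [Fintype ι] {w : Fin (m + 1) → Fin b → K} {c t : ι → K}
    (h : ∀ n, recSeq w n = ∑ i, c i * t i ^ n) :
    curveForm d w = ∑ i, c i • powForm d (fun k => (curveCoord w k).eval (t i)) := by
  funext e
  simp only [curveForm, curveMoment, recFun_eq_sum_eval h, Finset.sum_apply, Pi.smul_apply,
    powForm, smul_eq_mul, Finset.mul_sum, Polynomial.eval_prod, Polynomial.eval_pow]
  exact Finset.sum_congr rfl fun i _ => by ring

/-- The exponent of `x_0 ^ (d - n) x_1 ^ n`. -/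
noncomputable def expo (m d n : ℕ) : Fin (m + 1) →₀ ℕ :=
  Finsupp.single 0 (d - n) + Finsupp.single 1 n

/-- The exponent of `x_0 ^ (d - 1 - n) x_1 ^ n x_k`. -/
noncomputable def expo' (d : ℕ) {m : ℕ} (k : Fin (m + 1)) (n : ℕ) : Fin (m + 1) →₀ ℕ :=
  Finsupp.single 0 (d - 1 - n) + Finsupp.single 1 n + Finsupp.single k 1

/-- The Hankel matrix of the moments in the first two variables. -/
noncomputable def hankel (b : ℕ) (f : Form K m d) : Matrix (Fin b) (Fin b) K :=
  Matrix.of fun i j => mom f (expo m d (i + j))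

/-- The parameter of a form with nonsingular Hankel matrix. -/
noncomputable def chartCoord (b : ℕ) (f : Form K m d) : Fin (m + 1) → Fin b → K := fun k =>
  if k = 0 then fun j => mom f (expo m d j)
  else if k = 1 then (hankel b f)⁻¹.mulVec fun i => mom f (expo m d (b + i))
  else (hankel b f)⁻¹.mulVec fun i => mom f (expo' d k i)

theorem sum_single_apply {ι : Type} [Fintype ι] (k : ι) (n : ℕ) :
    ∑ x, Finsupp.single k n x = n := by
  classical
  simp [Finsupp.single_apply]

theorem prod_pow_single {ι R : Type} [Fintype ι] [CommRing R] (a : ι → R) (k : ι) (n : ℕ) :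
    ∏ x, a x ^ Finsupp.single k n x = a k ^ n := by
  classical
  rw [Finset.prod_eq_single k] <;> simp +contextual [eq_comm]

theorem sum_expo {n : ℕ} (h : n ≤ d) : ∑ k, expo m d n k = d := by
  simp only [expo, Finsupp.add_apply, Finset.sum_add_distrib, sum_single_apply]
  omega

theorem sum_expo' (k : Fin (m + 1)) {n : ℕ} (h : n + 1 ≤ d) : ∑ i, expo' d k n i = d := by
  simp only [expo', Finsupp.add_apply, Finset.sum_add_distrib, sum_single_apply]
  omega

theorem prod_pow_expo {R : Type} [CommRing R] (a : Fin (m + 1) → R) (n : ℕ) :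
    ∏ k, a k ^ expo m d n k = a 0 ^ (d - n) * a 1 ^ n := by
  simp only [expo, Finsupp.add_apply, pow_add, Finset.prod_mul_distrib, prod_pow_single]

theorem prod_pow_expo' {R : Type} [CommRing R] (a : Fin (m + 1) → R) (k : Fin (m + 1)) (n : ℕ) :
    ∏ i, a i ^ expo' d k n i = a 0 ^ (d - 1 - n) * a 1 ^ n * a k := by
  simp only [expo', Finsupp.add_apply, pow_add, Finset.prod_mul_distrib, prod_pow_single, pow_one]

theorem curveCoord_zero {R : Type} [CommRing R] (w : Fin (m + 1) → Fin b → R) :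
    curveCoord w 0 = 1 := by
  simp [curveCoord]

theorem curveCoord_one {R : Type} [CommRing R] (w : Fin (m + 2 + 1) → Fin b → R) :
    curveCoord w 1 = Polynomial.X := by
  simp [curveCoord]

theorem curveCoord_of_ne {R : Type} [CommRing R] (w : Fin (m + 1) → Fin b → R) {k : Fin (m + 1)}
    (h0 : k ≠ 0) (h1 : k ≠ 1) :
    curveCoord w k = ∑ j, Polynomial.C (w k j) * Polynomial.X ^ (j : ℕ) := by
  simp [curveCoord, h0, h1]

theorem curveMoment_expo {R : Type} [CommRing R] (w : Fin (m + 2 + 1) → Fin b → R) (n : ℕ) :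
    curveMoment w (expo (m + 2) d n) = recSeq w n := by
  rw [curveMoment, prod_pow_expo, curveCoord_zero, curveCoord_one, one_pow, one_mul, recFun_X_pow]

theorem curveMoment_expo' {R : Type} [CommRing R] (w : Fin (m + 2 + 1) → Fin b → R)
    {k : Fin (m + 2 + 1)} (h0 : k ≠ 0) (h1 : k ≠ 1) (n : ℕ) :
    curveMoment w (expo' d k n) = ∑ j, w k j * recSeq w (n + j) := by
  rw [curveMoment, prod_pow_expo', curveCoord_zero, curveCoord_one, one_pow, one_mul,
    curveCoord_of_ne w h0 h1, Finset.mul_sum, map_sum]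
  refine Finset.sum_congr rfl fun j _ => ?_
  rw [mul_left_comm, ← pow_add, recFun_C_mul, recFun_X_pow]

theorem hankel_curveForm [CharZero K] (hd : 2 * b - 1 ≤ d) (w : Fin (m + 2 + 1) → Fin b → K)
    (i j : Fin b) : hankel b (curveForm d w) i j = recSeq w (i + j) := by
  rw [hankel, Matrix.of_apply, mom_curveForm _ (sum_expo (by omega)), curveMoment_expo]

/-- The recurrence at indices `b, …, 2b - 1`, and likewise the moments involving `x_k`, are linear
systems for rows 1 and `k` with the Hankel matrix as matrix. -/
theorem chartCoord_curveForm [CharZero K] (hd : 2 * b - 1 ≤ d)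
    (w : Fin (m + 2 + 1) → Fin b → K) (hw : (hankel b (curveForm d w)).det ≠ 0) :
    chartCoord b (curveForm d w) = w := by
  have hu : IsUnit (hankel b (curveForm d w)).det := isUnit_iff_ne_zero.2 hw
  have key : ∀ (v γ : Fin b → K), (∀ i : Fin b, v i = ∑ j, γ j * recSeq w (i + j)) →
      (hankel b (curveForm d w))⁻¹.mulVec v = γ := by
    intro v γ h
    have : v = (hankel b (curveForm d w)).mulVec γ := by
      funext i
      simp [Matrix.mulVec, dotProduct, hankel_curveForm hd, h, mul_comm]
    rw [this, Matrix.mulVec_mulVec, Matrix.nonsing_inv_mul _ hu, Matrix.one_mulVec]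
  funext k
  by_cases h0 : k = 0
  · subst h0
    funext j
    simp only [chartCoord, if_true]
    rw [mom_curveForm _ (sum_expo (by omega)), curveMoment_expo, recSeq_of_lt]
  by_cases h1 : k = 1
  · subst h1
    simp only [chartCoord, h0, if_false, if_true]
    refine key _ _ fun i => ?_
    rw [mom_curveForm _ (sum_expo (by omega)), curveMoment_expo, add_comm b, recSeq_add]
  · simp only [chartCoord, h0, h1, if_false]
    refine key _ _ fun i => ?_
    rw [mom_curveForm _ (sum_expo' _ (by omega)), curveMoment_expo' w h0 h1]

theorem hankel_sum_smul [CharZero K] {ι : Type} [Fintype ι] (hd : 2 * b - 1 ≤ d) (c : ι → K)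
    (a : ι → Fin (m + 1) → K) :
    hankel b (∑ i, c i • powForm d (a i)) =
      (Matrix.of fun i (j : Fin b) =>
          c i * a i 0 ^ (d + 1 - b - j) * a i 1 ^ (j : ℕ)).transpose *
        Matrix.of fun i (j : Fin b) => a i 0 ^ (b - 1 - j) * a i 1 ^ (j : ℕ) := by
  ext j k
  rw [hankel, Matrix.of_apply, mom_sum_smul, Matrix.mul_apply]
  refine Finset.sum_congr rfl fun i _ => ?_
  rw [mom_powForm _ (sum_expo (by omega)), prod_pow_expo]
  have : d - (j + k) = (d + 1 - b - j) + (b - 1 - k) := by omega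
  simp only [Matrix.transpose_apply, Matrix.of_apply]
  rw [this, pow_add, pow_add]
  ring

/-- The Hankel matrix of a sum of `b` powers factors into two Vandermonde-like square matrices, both
of which must be nonsingular. -/
theorem ne_zero_of_det_hankel_ne_zero [CharZero K] (hd : 2 * b - 1 ≤ d) {c : Fin b → K}
    {a : Fin b → Fin (m + 1) → K}
    (h : (hankel b (∑ i, c i • powForm d (a i))).det ≠ 0) :
    (∀ i, c i ≠ 0) ∧ (∀ i, a i 0 ≠ 0) ∧ Function.Injective fun i => a i 1 / a i 0 := by
  rw [hankel_sum_smul hd, Matrix.det_mul, Matrix.det_transpose] at h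
  have hA := left_ne_zero_of_mul h
  have hB := right_ne_zero_of_mul h
  have h0 : ∀ i, a i 0 ≠ 0 := by
    intro i hi
    refine hA (Matrix.det_eq_zero_of_row_eq_zero i fun j => ?_)
    -- In the factorization this factor carries the larger exponent of `a i 0`, positive even for `j
    -- = b - 1`, so a point with `a i 0 = 0` gives a zero row.
    have : d + 1 - b - j ≠ 0 := by omega
    simp [hi, this]
  refine ⟨fun i hi => hA (Matrix.det_eq_zero_of_row_eq_zero i fun j => by simp [hi]), h0, ?_⟩
  intro i i' hii
  by_contra hne
  refine hB ?_
  have hrow : ∀ (l : Fin b) (j : Fin b), a l 0 ^ (b - 1 - j) * a l 1 ^ (j : ℕ) =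
      a l 0 ^ (b - 1) * (a l 1 / a l 0) ^ (j : ℕ) := by
    intro l j
    have : b - 1 = (b - 1 - j) + j := by omega
    rw [div_pow, this, pow_add, ← this]
    field_simp [h0 l]
  simp only at hii
  simp_rw [hrow]
  have : (Matrix.of fun (l j : Fin b) => a l 0 ^ (b - 1) * (a l 1 / a l 0) ^ (j : ℕ)) =
      Matrix.of fun l j => (fun l => a l 0 ^ (b - 1)) l *
        Matrix.vandermonde (fun l => a l 1 / a l 0) l j := rfl
  rw [this, Matrix.det_mul_column, Matrix.det_vandermonde_eq_zero_iff.2 ⟨i, i', hii, hne⟩, mul_zero]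

/-- Points with distinct slopes `t i` lie on an interpolating curve. -/
theorem exists_curveForm_eq [CharZero K] (hd : 2 * b - 1 ≤ d) {c : Fin b → K}
    {a : Fin b → Fin (m + 2 + 1) → K}
    (h : (hankel b (∑ i, c i • powForm d (a i))).det ≠ 0) :
    ∃ w : Fin (m + 2 + 1) → Fin b → K, ∑ i, c i • powForm d (a i) = curveForm d w := by
  obtain ⟨-, h0, hinj⟩ := ne_zero_of_det_hankel_ne_zero hd h
  set t : Fin b → K := fun i => a i 1 / a i 0 with ht
  have hV : IsUnit (Matrix.vandermonde t).det :=
    isUnit_iff_ne_zero.2 (Matrix.det_vandermonde_ne_zero_iff.2 hinj)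
  have hsolve : ∀ y : Fin b → K, ∃ x : Fin b → K, ∀ i, ∑ j, x j * t i ^ (j : ℕ) = y i := by
    intro y
    refine ⟨(Matrix.vandermonde t)⁻¹.mulVec y, fun i => ?_⟩
    have := congrFun (Matrix.mulVec_mulVec y (Matrix.vandermonde t) (Matrix.vandermonde t)⁻¹) i
    rw [Matrix.mul_nonsing_inv _ hV, Matrix.one_mulVec] at this
    rw [← this]
    simp [Matrix.mulVec, dotProduct, mul_comm]
  choose X hX using hsolve
  let w : Fin (m + 2 + 1) → Fin b → K := fun k =>
    if k = 0 then fun j => ∑ i, (c i * a i 0 ^ d) * t i ^ (j : ℕ)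
    -- Interpolating `t ^ b` at the `t i` makes them the roots of `recPoly w`; the weights `a i 0 ^
    -- d` in row 0 compensate for scaling the points to first coordinate 1.
    else if k = 1 then X fun i => t i ^ b
    else X fun i => a i k / a i 0
  have hw0 : ∀ j : Fin b, ∑ i, (c i * a i 0 ^ d) * t i ^ (j : ℕ) = w 0 j := fun j => by simp [w]
  have hroot : ∀ i, (recPoly w).eval (t i) = 0 := by
    intro i
    rw [eval_recPoly, sub_eq_zero]
    have h1 : w 1 = X fun i => t i ^ b := by simp [w]
    rw [h1, hX]
  refine ⟨w, ?_⟩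
  rw [curveForm_eq_sum (recSeq_eq_sum_pow hroot hw0)]
  refine Finset.sum_congr rfl fun i _ => ?_
  have hc : ∀ k, a i k = a i 0 * (curveCoord w k).eval (t i) := by
    intro k
    by_cases hk0 : k = 0
    · subst hk0; simp [curveCoord_zero]
    by_cases hk1 : k = 1
    · subst hk1; simp [curveCoord_one, ht, mul_div_cancel₀ _ (h0 i)]
    · rw [curveCoord_of_ne w hk0 hk1]
      have hwk : w k = X fun i => a i k / a i 0 := by simp [w, hk0, hk1]
      simp [Polynomial.eval_finsetSum, hwk, hX, mul_div_cancel₀ _ (h0 i)]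
  funext e
  have he := mem_antidiag_iff.1 e.2
  simp only [Pi.smul_apply, powForm, smul_eq_mul]
  rw [Finset.prod_congr rfl fun k _ => by rw [hc k, mul_pow], Finset.prod_mul_distrib,
    Finset.prod_pow_eq_pow_sum, he]
  ring

theorem curveForm_chartCoord_of_isSumOfPowers [CharZero K] (hd : 2 * b - 1 ≤ d)
    {f : Form K (m + 2) d} (hf : IsSumOfPowers b f) (h : (hankel b f).det ≠ 0) :
    curveForm d (chartCoord b f) = f := by
  obtain ⟨c, a, rfl⟩ := isSumOfPowers_iff.1 hf
  obtain ⟨w, hw⟩ := exists_curveForm_eq hd h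
  rw [hw] at h ⊢
  rw [chartCoord_curveForm hd w h]

theorem IsSumOfPowers.mono {s t : ℕ} (hst : s ≤ t) {f : Form K m d} (hf : IsSumOfPowers s f) :
    IsSumOfPowers t f := by
  obtain ⟨c, a, rfl⟩ := isSumOfPowers_iff.1 hf
  obtain ⟨r, rfl⟩ := Nat.exists_eq_add_of_le hst
  refine isSumOfPowers_iff.2 ⟨Fin.append c 0, Fin.append a 0, ?_⟩
  simp [Fin.sum_univ_add]

/-- A shorter decomposition, padded with zeros to length `b`, would have a zero coefficient. -/
theorem le_of_isSumOfPowers [CharZero K] (hd : 2 * b - 1 ≤ d) {f : Form K m d}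
    (h : (hankel b f).det ≠ 0) {s : ℕ} (hs : IsSumOfPowers s f) : b ≤ s := by
  by_contra! hlt
  obtain ⟨c, a, rfl⟩ := isSumOfPowers_iff.1 hs
  obtain ⟨r, rfl⟩ : ∃ r, b = s + (r + 1) := ⟨b - s - 1, by omega⟩
  have := (ne_zero_of_det_hankel_ne_zero (K := K) hd (c := Fin.append c (0 : Fin (r + 1) → K))
    (a := Fin.append a 0) (by simpa [Fin.sum_univ_add] using h)).1 (Fin.natAdd s 0)
  simp at this

theorem exists_coeff_of_roots {w : Fin (m + 1) → Fin b → K} {t : Fin b → K}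
    (hinj : Function.Injective t) (ht : ∀ i, (recPoly w).eval (t i) = 0) :
    ∃ c : Fin b → K, ∀ n, recSeq w n = ∑ i, c i * t i ^ n := by
  have hV : IsUnit (Matrix.vandermonde t).det :=
    isUnit_iff_ne_zero.2 (Matrix.det_vandermonde_ne_zero_iff.2 hinj)
  refine ⟨Matrix.vecMul (w 0) (Matrix.vandermonde t)⁻¹, recSeq_eq_sum_pow ht fun j => ?_⟩
  have := congrFun (Matrix.vecMul_vecMul (w 0) (Matrix.vandermonde t)⁻¹ (Matrix.vandermonde t)) j
  rw [Matrix.nonsing_inv_mul _ hV, Matrix.vecMul_one] at this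
  rw [← this]
  rfl

end ChartField

end RealTypicalRank

/-! ### Smoothness of the chart, passage to the closure, and real points. -/

namespace RealTypicalRank

open Finset Filter Topology
open scoped ContDiff

section Smooth

variable {𝕜 : Type} [RCLike 𝕜] {m b d : ℕ}

theorem contDiff_mom (e : Fin (m + 1) →₀ ℕ) : ContDiff 𝕜 ∞ fun f : Form 𝕜 m d => mom f e := by
  unfold mom
  split_ifs with h
  · exact (contDiff_apply 𝕜 𝕜 (⟨e, h⟩ : Exps m d)).div_const _
  · exact contDiff_const

theorem contDiff_det {E n : Type} [NormedAddCommGroup E] [NormedSpace 𝕜 E] [Fintype n]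
    [DecidableEq n] {M : E → Matrix n n 𝕜} (h : ∀ i j, ContDiff 𝕜 ∞ fun x => M x i j) :
    ContDiff 𝕜 ∞ fun x => (M x).det := by
  simp only [Matrix.det_apply']
  exact ContDiff.sum fun σ _ => contDiff_const.mul (contDiff_prod fun i _ => h _ _)

theorem contDiff_det_hankel : ContDiff 𝕜 ∞ fun f : Form 𝕜 m d => (hankel b f).det :=
  contDiff_det fun _ _ => contDiff_mom _

theorem contDiffAt_chartCoord {f : Form 𝕜 m d} (hf : (hankel b f).det ≠ 0) :
    ContDiffAt 𝕜 ∞ (chartCoord b : Form 𝕜 m d → Fin (m + 1) → Fin b → 𝕜) f := by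
  have key : ∀ v : Fin b → Fin (m + 1) →₀ ℕ, ContDiffAt 𝕜 ∞
      (fun f : Form 𝕜 m d => (hankel b f)⁻¹.mulVec fun i => mom f (v i)) f := by
    intro v
    refine contDiffAt_pi.2 fun j => ?_
    simp only [Matrix.mulVec, dotProduct, Matrix.inv_def, Matrix.smul_apply, Ring.inverse_eq_inv',
      smul_eq_mul, Matrix.adjugate_apply]
    refine ContDiffAt.sum fun i _ => ContDiffAt.mul (ContDiffAt.mul ?_ ?_) ?_
    · exact contDiff_det_hankel.contDiffAt.inv hf
    · refine (contDiff_det fun k l => ?_).contDiffAt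
      by_cases hk : k = i
      · subst hk
        simp only [Matrix.updateRow_self]
        exact contDiff_const
      · simp only [Matrix.updateRow_ne hk]
        exact contDiff_mom _
    · exact (contDiff_mom _).contDiffAt
  refine contDiffAt_pi.2 fun k => ?_
  unfold chartCoord
  split_ifs
  · exact contDiffAt_pi.2 fun j => (contDiff_mom _).contDiffAt
  · exact key _
  · exact key _

theorem isOpen_det_hankel_ne_zero : IsOpen {f : Form 𝕜 m d | (hankel b f).det ≠ 0} :=
  isOpen_ne_fun contDiff_det_hankel.continuous continuous_const

theorem continuousOn_chartCoord :
    ContinuousOn (chartCoord b : Form 𝕜 m d → Fin (m + 1) → Fin b → 𝕜)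
      {f | (hankel b f).det ≠ 0} :=
  fun _ hf => (contDiffAt_chartCoord hf).continuousAt.continuousWithinAt

/-- The moments are specializations of the moments of the generic parameter, hence polynomial in
`w`. -/
theorem contDiff_curveForm :
    ContDiff 𝕜 ∞ (curveForm d : (Fin (m + 1) → Fin b → 𝕜) → Form 𝕜 m d) := by
  refine contDiff_pi.2 fun e => contDiff_const.mul ?_
  have h : ∀ w : Fin (m + 1) → Fin b → 𝕜, curveMoment w e =
      MvPolynomial.aeval (fun p : Fin (m + 1) × Fin b => w p.1 p.2)
        (curveMoment (fun k j => MvPolynomial.X (R := 𝕜) (k, j)) (e : Fin (m + 1) →₀ ℕ)) := by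
    intro w
    have := curveMoment_map ((MvPolynomial.aeval (R := 𝕜)
      (fun p : Fin (m + 1) × Fin b => w p.1 p.2)).toRingHom)
      (fun k j => MvPolynomial.X (R := 𝕜) (k, j)) (e : Fin (m + 1) →₀ ℕ)
    simpa using this
  simp_rw [h]
  refine contDiff_iff_contDiffAt.2 fun w => (AnalyticAt.aeval_mvPolynomial (fun p => ?_) _).contDiffAt
  exact (((ContinuousLinearMap.proj (R := 𝕜) (φ := fun _ : Fin b => 𝕜) p.2).comp
    (ContinuousLinearMap.proj (R := 𝕜) (φ := fun _ : Fin (m + 1) => Fin b → 𝕜) p.1))).analyticAt w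

end Smooth

section Closure

variable {m b d : ℕ}

/-- The identity holds for sums of `b` powers, and both sides are continuous where the Hankel
determinant is nonzero, so it passes to limits. -/
theorem curveForm_chartCoord_of_mem_secantCone (hd : 2 * b - 1 ≤ d) {f : Form ℂ (m + 2) d}
    (hf : f ∈ secantCone (m + 2) d b) (h : (hankel b f).det ≠ 0) :
    curveForm d (chartCoord b f) = f := by
  set S := {f : Form ℂ (m + 2) d | IsSumOfPowers b f} ∩ {f | (hankel b f).det ≠ 0}
  have hcl : f ∈ closure S := by
    exact isOpen_det_hankel_ne_zero.closure_inter ⟨hf, h⟩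
  have : NeBot (𝓝[S] f) := mem_closure_iff_nhdsWithin_neBot.1 hcl
  have h1 : Tendsto (fun g => curveForm d (chartCoord b g)) (𝓝[S] f)
      (𝓝 (curveForm d (chartCoord b f))) :=
    ((contDiff_curveForm (𝕜 := ℂ)).continuous.continuousAt.comp
      (contDiffAt_chartCoord h).continuousAt).tendsto.mono_left nhdsWithin_le_nhds
  have h2 : Tendsto (fun g => curveForm d (chartCoord b g)) (𝓝[S] f) (𝓝 f) := by
    refine Tendsto.congr' ?_ (tendsto_id.mono_left nhdsWithin_le_nhds)
    filter_upwards [self_mem_nhdsWithin] with g hg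
    exact (curveForm_chartCoord_of_isSumOfPowers hd hg.1 hg.2).symm
  exact tendsto_nhds_unique h1 h2

/-- A multiple root of `p - ε` is a critical point of `p`, so the bad `ε` are critical values. -/
theorem finite_not_separable_sub_C {p : Polynomial ℂ} (hp : p.natDegree ≠ 0) :
    {ε : ℂ | ¬ (p - Polynomial.C ε).Separable}.Finite := by
  have hder : Polynomial.derivative p ≠ 0 := fun h =>
    hp (Polynomial.derivative_eq_zero.1 h)
  refine ((Polynomial.derivative p).roots.toFinset.finite_toSet.image fun z => p.eval z).subset ?_
  intro ε hε
  by_contra hcon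
  refine hε ?_
  rw [Polynomial.separable_def, Polynomial.isCoprime_iff_aeval_ne_zero_of_isAlgClosed ℂ ℂ]
  intro z
  by_contra! hz
  refine hcon ⟨z, ?_, ?_⟩
  · simpa [hder, Polynomial.IsRoot] using hz.2
  · have := hz.1
    simpa [sub_eq_zero] using this

theorem exists_roots_of_separable {p : Polynomial ℂ} (hp : p.Separable) (hdeg : p.natDegree = b) :
    ∃ t : Fin b → ℂ, Function.Injective t ∧ (∀ i, p.eval (t i) = 0) ∧
      ∀ z, p.eval z = 0 → ∃ i, t i = z := by
  have hcard : p.roots.toFinset.card = b := by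
    rw [Multiset.toFinset_card_of_nodup (Polynomial.nodup_roots hp),
      ← (IsAlgClosed.splits p).natDegree_eq_card_roots, hdeg]
  let e := p.roots.toFinset.equivFinOfCardEq hcard
  refine ⟨fun i => (e.symm i : ℂ), fun i j h => e.symm.injective (Subtype.ext h), fun i => ?_, ?_⟩
  · have := (e.symm i).2
    rw [Multiset.mem_toFinset, Polynomial.mem_roots hp.ne_zero] at this
    exact this
  · intro z hz
    have : z ∈ p.roots.toFinset := by
      rw [Multiset.mem_toFinset, Polynomial.mem_roots hp.ne_zero]
      exact hz
    exact ⟨e ⟨z, this⟩, by simp⟩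

/-- The parameter with `ε` added to one entry. -/
noncomputable def shiftParam {R : Type} [CommRing R] (k₀ : Fin (m + 1)) (j₀ : ℕ)
    (w : Fin (m + 1) → Fin b → R) (ε : R) : Fin (m + 1) → Fin b → R :=
  fun k j => w k j + if k = k₀ ∧ (j : ℕ) = j₀ then ε else 0

theorem shiftParam_zero {R : Type} [CommRing R] (k₀ : Fin (m + 1)) (j₀ : ℕ)
    (w : Fin (m + 1) → Fin b → R) : shiftParam k₀ j₀ w 0 = w := by
  funext k j
  simp [shiftParam]

theorem continuous_shiftParam {R : Type} [CommRing R] [TopologicalSpace R] [IsTopologicalRing R]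
    (k₀ : Fin (m + 1)) (j₀ : ℕ) (w : Fin (m + 1) → Fin b → R) :
    Continuous (shiftParam k₀ j₀ w) := by
  refine continuous_pi fun k => continuous_pi fun j => ?_
  unfold shiftParam
  split_ifs <;> fun_prop

theorem recPoly_shiftParam {R : Type} [CommRing R] (hb : 0 < b) (w : Fin (m + 1) → Fin b → R)
    (ε : R) : recPoly (shiftParam 1 0 w ε) = recPoly w - Polynomial.C ε := by
  have h : ∑ j : Fin b, (Polynomial.C (if (j : ℕ) = 0 then ε else 0) * Polynomial.X ^ (j : ℕ)) =
      Polynomial.C ε := by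
    rw [Finset.sum_eq_single ⟨0, hb⟩]
    · simp
    · intro j _ hj
      have : (j : ℕ) ≠ 0 := fun h => hj (Fin.ext h)
      simp [this]
    · simp
  rw [recPoly_eq, recPoly_eq, sub_sub]
  congr 1
  rw [← h, ← Finset.sum_add_distrib]
  refine Finset.sum_congr rfl fun j _ => ?_
  simp only [shiftParam, true_and, Polynomial.C_add, add_mul]

theorem isSumOfPowers_curveForm {w : Fin (m + 1) → Fin b → ℂ} (hw : (recPoly w).Separable) :
    IsSumOfPowers b (curveForm d w) := by
  obtain ⟨t, hinj, ht, -⟩ := exists_roots_of_separable hw (natDegree_recPoly w)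
  obtain ⟨c, hc⟩ := exists_coeff_of_roots hinj ht
  exact isSumOfPowers_iff.2 ⟨_, _, curveForm_eq_sum hc⟩

/-- Shifting the constant coefficient of the recurrence polynomial makes its roots distinct, so the
form is a limit of sums of `b` powers. -/
theorem curveForm_mem_secantCone (hb : 0 < b) (w : Fin (m + 1) → Fin b → ℂ) :
    curveForm d w ∈ secantCone m d b := by
  have hcont : Continuous fun ε : ℂ => curveForm d (shiftParam 1 0 w ε) :=
    (contDiff_curveForm (𝕜 := ℂ)).continuous.comp (continuous_shiftParam 1 0 w)
  have hfin := finite_not_separable_sub_C (p := recPoly w) (by rw [natDegree_recPoly]; omega)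
  have hlim : Tendsto (fun ε : ℂ => curveForm d (shiftParam 1 0 w ε)) (𝓝[≠] 0) (𝓝 (curveForm d w)) := by
    have := (hcont.tendsto 0).mono_left (nhdsWithin_le_nhds (s := {0}ᶜ))
    rwa [shiftParam_zero] at this
  refine mem_closure_of_tendsto hlim ?_
  have h1 : ({ε : ℂ | ¬ (recPoly w - Polynomial.C ε).Separable} \ {0})ᶜ ∈ 𝓝 (0 : ℂ) :=
    (hfin.subset Set.sdiff_subset).isClosed.isOpen_compl.mem_nhds (by simp)
  filter_upwards [self_mem_nhdsWithin, nhdsWithin_le_nhds h1] with ε hε hε'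
  refine isSumOfPowers_curveForm ?_
  rw [recPoly_shiftParam hb]
  by_contra hcon
  exact hε' ⟨hcon, hε⟩

end Closure

section Real

variable {m b d : ℕ}

theorem curveForm_map {K L : Type} [Field K] [Field L] (φ : K →+* L)
    (w : Fin (m + 1) → Fin b → K) :
    curveForm d (fun k j => φ (w k j)) = fun e => φ (curveForm d w e) := by
  funext e
  simp [curveForm, curveMoment_map, mult]

theorem mom_map {K L : Type} [Field K] [Field L] (φ : K →+* L) (f : Form K m d)
    (e : Fin (m + 1) →₀ ℕ) : mom (fun e => φ (f e)) e = φ (mom f e) := by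
  unfold mom
  split_ifs <;> simp [mult]

theorem det_hankel_map {K L : Type} [Field K] [Field L] (φ : K →+* L) (f : Form K m d) :
    (hankel b (fun e => φ (f e))).det = φ (hankel b f).det := by
  rw [RingHom.map_det]
  congr 1
  ext i j
  simp [hankel, mom_map]

theorem ne_zero_of_det_hankel {K : Type} [Field K] (hb : 0 < b) {f : Form K m d}
    (h : (hankel b f).det ≠ 0) : f ≠ 0 := by
  rintro rfl
  refine h (Matrix.det_eq_zero_of_row_eq_zero ⟨0, hb⟩ fun j => ?_)
  simp only [hankel, Matrix.of_apply, mom]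
  split_ifs <;> simp

theorem curveForm_mem_realSecant (hb : 0 < b) {w : Fin (m + 1) → Fin b → ℝ}
    (h : (hankel b (curveForm d w)).det ≠ 0) : curveForm d w ∈ realSecant m d b := by
  refine ⟨ne_zero_of_det_hankel hb h, ?_⟩
  have := curveForm_map (d := d) Complex.ofRealHom w
  simp only [Complex.ofRealHom_eq_coe] at this
  rw [← this]
  exact curveForm_mem_secantCone hb _

/-- The complex parameter of a real form is unique, hence equal to its own conjugate. -/
theorem exists_curveForm_eq_of_mem_realSecant (hd : 2 * b - 1 ≤ d) {f : Form ℝ (m + 2) d}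
    (hf : f ∈ realSecant (m + 2) d b) (h : (hankel b f).det ≠ 0) :
    ∃ w : Fin (m + 2 + 1) → Fin b → ℝ, curveForm d w = f := by
  set g : Form ℂ (m + 2) d := fun e => (f e : ℂ) with hg
  have hdet : (hankel b g).det ≠ 0 := by
    have := det_hankel_map (b := b) Complex.ofRealHom f
    simp only [Complex.ofRealHom_eq_coe] at this
    rw [hg, this]
    exact_mod_cast h
  have h1 := curveForm_chartCoord_of_mem_secantCone hd hf.2 hdet
  set w := chartCoord b g
  have h2 : curveForm d (fun k j => (starRingEnd ℂ) (w k j)) = g := by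
    rw [curveForm_map, h1]
    funext e
    simp [hg]
  have h3 : (fun k j => (starRingEnd ℂ) (w k j)) = w := by
    have := chartCoord_curveForm hd (fun k j => (starRingEnd ℂ) (w k j)) (by rw [h2]; exact hdet)
    rw [← this, h2]
  refine ⟨fun k j => (w k j).re, ?_⟩
  have h4 : (fun k j => Complex.ofRealHom ((w k j).re)) = w := by
    funext k j
    exact Complex.conj_eq_iff_re.1 (congrFun (congrFun h3 k) j)
  have h5 := curveForm_map (d := d) Complex.ofRealHom (fun k j => (w k j).re)
  rw [h4, h1] at h5
  funext e
  have := congrFun h5 e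
  simp only [Complex.ofRealHom_eq_coe] at this
  exact_mod_cast this.symm

theorem image_curveForm_eq (hb : 0 < b) (hd : 2 * b - 1 ≤ d)
    {B : Set (Fin (m + 2 + 1) → Fin b → ℝ)} (hB : ∀ w ∈ B, (hankel b (curveForm d w)).det ≠ 0) :
    curveForm d '' B = realSecant (m + 2) d b ∩
      ({f | (hankel b f).det ≠ 0} ∩ chartCoord b ⁻¹' B) := by
  ext f
  constructor
  · rintro ⟨w, hw, rfl⟩
    refine ⟨curveForm_mem_realSecant hb (hB w hw), hB w hw, ?_⟩
    rw [Set.mem_preimage, chartCoord_curveForm hd w (hB w hw)]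
    exact hw
  · rintro ⟨hf, hdet, hmem⟩
    obtain ⟨w, rfl⟩ := exists_curveForm_eq_of_mem_realSecant hd hf hdet
    rw [Set.mem_preimage, chartCoord_curveForm hd w hdet] at hmem
    exact ⟨w, hmem, rfl⟩

theorem isOpen_chart {B : Set (Fin (m + 1) → Fin b → ℝ)} (hB : IsOpen B) :
    IsOpen ({f : Form ℝ m d | (hankel b f).det ≠ 0} ∩ chartCoord b ⁻¹' B) :=
  continuousOn_chartCoord.isOpen_inter_preimage isOpen_det_hankel_ne_zero hB

/-- `chartCoord` is a smooth left inverse, which gives both the injective derivative and the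
embedding. -/
theorem isSubmanifold_image_curveForm (hd : 2 * b - 1 ≤ d)
    {B : Set (Fin (m + 2 + 1) → Fin b → ℝ)} (hBo : IsOpen B)
    (hB : ∀ w ∈ B, (hankel b (curveForm d w)).det ≠ 0) :
    IsSubmanifold ((m + 3) * b) (curveForm d '' B) := by
  let ι : EuclideanSpace ℝ (Fin ((m + 3) * b)) ≃L[ℝ] (Fin (m + 2 + 1) → Fin b → ℝ) :=
    ContinuousLinearEquiv.ofFinrankEq (by simp [Module.finrank_pi_fintype])
  have hleft : ∀ v ∈ ι ⁻¹' B, ι.symm (chartCoord b (curveForm d (ι v))) = v := fun v hv => by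
    rw [chartCoord_curveForm hd _ (hB _ hv), ι.symm_apply_apply]
  have hcd : ContDiff ℝ ∞ fun v => curveForm d (ι v) := contDiff_curveForm.comp ι.contDiff
  have hW : IsOpen (ι ⁻¹' B) := hBo.preimage ι.continuous
  have himg : (fun v => curveForm d (ι v)) '' (ι ⁻¹' B) = curveForm d '' B := by
    rw [← Set.image_image (curveForm d) ι, Set.image_preimage_eq _ ι.surjective]
  rintro _ hx
  refine ⟨ι ⁻¹' B, fun v => curveForm d (ι v), hW, hcd.contDiffOn, fun v hv => ?_, ?_, ?_,
    Set.univ, isOpen_univ, ?_⟩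
  · have h1 : HasFDerivAt (fun v => curveForm d (ι v)) (fderiv ℝ (fun v => curveForm d (ι v)) v) v :=
      (hcd.differentiable (by simp) v).hasFDerivAt
    have h2 := ((contDiffAt_chartCoord (𝕜 := ℝ) (hB _ hv)).differentiableAt (by simp)).hasFDerivAt
    have h3 := (ι.symm.hasFDerivAt.comp _ h2).comp v h1
    have h4 : HasFDerivAt (fun v => ι.symm (chartCoord b (curveForm d (ι v))))
        (ContinuousLinearMap.id ℝ _) v := by
      refine (hasFDerivAt_id v).congr_of_eventuallyEq ?_
      filter_upwards [hW.mem_nhds hv] with u hu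
      exact hleft u hu
    have h5 := h3.unique h4
    intro x y hxy
    have hx := congrArg (fun L => L x) h5
    have hy := congrArg (fun L => L y) h5
    simp only [ContinuousLinearMap.comp_apply, ContinuousLinearMap.id_apply] at hx hy
    rw [← hx, ← hy, hxy]
  · let F : ι ⁻¹' B → {f : Form ℝ (m + 2) d | (hankel b f).det ≠ 0} :=
      fun v => ⟨curveForm d (ι v), hB _ v.2⟩
    let G : {f : Form ℝ (m + 2) d | (hankel b f).det ≠ 0} → EuclideanSpace ℝ (Fin ((m + 3) * b)) :=
      fun f => ι.symm (chartCoord b f.1)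
    have hF : Continuous F := (hcd.continuous.comp continuous_subtype_val).subtype_mk _
    have hG : Continuous G := ι.symm.continuous.comp
      (continuousOn_iff_continuous_domRestrict.1 continuousOn_chartCoord)
    have hGF : G ∘ F = Subtype.val := funext fun v => hleft v v.2
    have : IsEmbedding F := IsEmbedding.of_comp hF hG (hGF ▸ IsEmbedding.subtypeVal)
    exact IsEmbedding.subtypeVal.comp this
  · rw [himg]; exact hx
  · rw [himg, Set.inter_univ]

end Real

end RealTypicalRank

/-! ### Dimension of the secant cone and full-dimensional pieces. -/

namespace RealTypicalRank

open Finset Filter Topology MvPolynomial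
open scoped ContDiff

variable {m b d : ℕ}

/-- The polynomial map that sends `b` linear forms to the sum of their `d`-th powers. -/
noncomputable def powerSumHom (m d b : ℕ) :
    MvPolynomial (Exps m d) ℂ →ₐ[ℂ] MvPolynomial (Fin b × Fin (m + 1)) ℂ :=
  aeval fun e => C (mult ℂ (e : Fin (m + 1) →₀ ℕ)) *
    ∑ i, ∏ k, X (i, k) ^ (e : Fin (m + 1) →₀ ℕ) k

theorem eval_powerSumHom (P : MvPolynomial (Exps m d) ℂ) (a : Fin b × Fin (m + 1) → ℂ) :
    eval a (powerSumHom m d b P) = aeval (∑ i, powForm d (fun k => a (i, k))) P := by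
  rw [← aeval_eq_eval, powerSumHom]
  change aeval a (aeval _ P) = _
  rw [← AlgHom.comp_apply, comp_aeval]
  congr 2
  funext e
  simp [powForm, Finset.mul_sum, Finset.sum_apply]

theorem isSumOfPowers_iff_complex (hd : d ≠ 0) {f : Form ℂ m d} :
    IsSumOfPowers b f ↔ ∃ a : Fin b → Fin (m + 1) → ℂ, f = ∑ i, powForm d (a i) := by
  rw [isSumOfPowers_iff]
  constructor
  · rintro ⟨c, a, rfl⟩
    choose r hr using fun i => IsAlgClosed.exists_pow_nat_eq (c i) (Nat.pos_of_ne_zero hd)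
    refine ⟨fun i k => r i * a i k, Finset.sum_congr rfl fun i _ => ?_⟩
    funext e
    have he := mem_antidiag_iff.1 e.2
    simp only [Pi.smul_apply, powForm, smul_eq_mul, mul_pow, Finset.prod_mul_distrib,
      Finset.prod_pow_eq_pow_sum, he, hr]
    ring
  · rintro ⟨a, rfl⟩
    exact ⟨fun _ => 1, a, by simp⟩

/-- Over ℂ the coefficients are absorbed by `d`-th roots, so the cone is the closure of a polynomial
image of an affine space. Its ideal is the kernel of a map to a polynomial ring, hence prime, and
the number of variables bounds the dimension. -/
theorem vanishingIdeal_secantCone (hd : d ≠ 0) :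
    vanishingIdeal ℂ (secantCone m d b) = RingHom.ker (powerSumHom m d b).toRingHom := by
  ext P
  rw [RingHom.mem_ker]
  constructor
  · intro hP
    refine MvPolynomial.funext fun a => ?_
    rw [map_zero]
    refine (eval_powerSumHom P a).trans (hP _ (subset_closure ?_))
    exact (isSumOfPowers_iff_complex hd).2 ⟨fun i k => a (i, k), rfl⟩
  · intro hP f hf
    have hclosed : IsClosed {f : Form ℂ m d | aeval f P = 0} := by
      simp_rw [aeval_eq_eval]
      exact isClosed_eq (MvPolynomial.continuous_eval P) continuous_const
    refine closure_minimal ?_ hclosed hf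
    intro g hg
    obtain ⟨a, rfl⟩ := (isSumOfPowers_iff_complex hd).1 hg
    have := eval_powerSumHom P fun p : Fin b × Fin (m + 1) => a p.1 p.2
    rw [Set.mem_ofPred_eq, ← this]
    have hP' : powerSumHom m d b P = 0 := hP
    rw [hP', map_zero]

theorem isPrime_vanishingIdeal_secantCone (hd : d ≠ 0) :
    (vanishingIdeal ℂ (secantCone m d b)).IsPrime := by
  rw [vanishingIdeal_secantCone hd]
  exact RingHom.ker_isPrime _

theorem trdeg_le_secantCone (hd : d ≠ 0) :
    Algebra.trdeg ℂ (MvPolynomial (Exps m d) ℂ ⧸ vanishingIdeal ℂ (secantCone m d b)) ≤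
      ((m + 1) * b : ℕ) := by
  have h : ∀ P ∈ vanishingIdeal ℂ (secantCone m d b), powerSumHom m d b P = 0 := fun P hP => by
    rw [vanishingIdeal_secantCone hd] at hP
    exact hP
  have hinj : Function.Injective (Ideal.Quotient.liftₐ _ (powerSumHom m d b) h) := by
    rw [injective_iff_map_eq_zero]
    intro x hx
    obtain ⟨P, rfl⟩ := Ideal.Quotient.mk_surjective x
    rw [Ideal.Quotient.eq_zero_iff_mem, vanishingIdeal_secantCone hd]
    exact hx
  refine (trdeg_le_of_injective _ hinj).trans ?_
  simp [mul_comm]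

/-- A parameter with nonsingular Hankel matrix, arbitrary recurrence and arbitrary curve. -/
theorem det_hankel_ne_zero_of_single {K : Type} [Field K] [CharZero K] (hb : 0 < b)
    (hd : 2 * b - 1 ≤ d) {w : Fin (m + 2 + 1) → Fin b → K}
    (hw : ∀ j : Fin b, w 0 j = if (j : ℕ) = b - 1 then 1 else 0) :
    (hankel b (curveForm d w)).det ≠ 0 := by
  have hlow : ∀ n, n < b → recSeq w n = if n = b - 1 then 1 else 0 := fun n hn => by
    exact (recSeq_of_lt w ⟨n, hn⟩).trans (hw ⟨n, hn⟩)
  -- With its columns reversed the Hankel matrix is lower triangular with ones on the diagonal.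
  have h := Matrix.det_permute' (Fin.revPerm : Equiv.Perm (Fin b)) (hankel b (curveForm d w))
  have h1 : ((hankel b (curveForm d w)).submatrix id (Fin.revPerm : Equiv.Perm (Fin b))).det = 1 := by
    rw [Matrix.det_of_isLowerTriangular]
    · refine Finset.prod_eq_one fun i _ => ?_
      rw [Matrix.submatrix_apply, hankel_curveForm hd, hlow _ (by simp [Fin.val_rev]; omega)]
      simp [Fin.val_rev]
      omega
    · intro i j hij
      have hij' : (i : ℕ) < j := hij
      rw [Matrix.submatrix_apply, hankel_curveForm hd, hlow _ (by simp [Fin.val_rev]; omega)]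
      simp [Fin.val_rev]
      omega
  intro h0
  rw [h0, mul_zero, h1] at h
  exact one_ne_zero h

/-- The upper bound counts the coefficients of `b` linear forms; the lower bound comes from the real
chart, which has the same number of parameters. -/
theorem coneDim_eq (hb : 0 < b) (hd : 2 * b - 1 ≤ d) :
    coneDim (m + 2) d b = (((m + 3) * b : ℕ) : WithBot ℕ∞) := by
  have hd0 : d ≠ 0 := by omega
  have := isPrime_vanishingIdeal_secantCone (m := m + 2) (b := b) hd0
  let B := {w : Fin (m + 2 + 1) → Fin b → ℝ | (hankel b (curveForm d w)).det ≠ 0}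
  have hBo : IsOpen B := isOpen_det_hankel_ne_zero.preimage (contDiff_curveForm (𝕜 := ℝ)).continuous
  have hsub := isSubmanifold_image_curveForm hd hBo fun w hw => hw
  have hne : (curveForm d '' B).Nonempty := by
    refine Set.Nonempty.image _ ⟨fun k j => if (j : ℕ) = b - 1 then 1 else 0, ?_⟩
    exact det_hankel_ne_zero_of_single hb hd fun j => rfl
  obtain ⟨T, -, hT⟩ := exists_algebraicIndependent_of_isSubmanifold
    (V := secantCone (m + 2) d b) (M := curveForm d '' B) (by
      rintro _ ⟨w, hw, rfl⟩
      exact (curveForm_mem_realSecant hb hw).2) hsub hne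
  refine ringKrullDim_eq_trdeg (k := ℂ) (le_antisymm (trdeg_le_secantCone hd0) ?_)
  simpa using hT.cardinalMk_le_trdeg

/-- The determinant of the Hankel matrix as a polynomial in the coefficients of the form. -/
noncomputable def hankelPoly (m d b : ℕ) : MvPolynomial (Exps m d) ℂ :=
  (Matrix.of fun i j : Fin b =>
    if h : expo m d (i + j) ∈ finsuppAntidiag univ d then
      X ⟨expo m d (i + j), h⟩ * C (mult ℂ (expo m d (i + j)))⁻¹ else 0).det

theorem aeval_hankelPoly (f : Form ℂ m d) : aeval f (hankelPoly m d b) = (hankel b f).det := by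
  rw [hankelPoly, AlgHom.map_det]
  congr 1
  ext i j
  simp only [AlgHom.mapMatrix_apply, Matrix.map_apply, Matrix.of_apply, hankel, mom]
  split_ifs <;> simp [div_eq_mul_inv]

/-- Every full-dimensional piece contains the forms attached to a nonempty open set of
parameters. -/
theorem IsTopPiece.exists_isOpen (hb : 0 < b) (hd : 2 * b - 1 ≤ d) {U : Set (Form ℝ (m + 2) d)}
    (hU : IsTopPiece (m + 2) d b U) :
    ∃ B : Set (Fin (m + 2 + 1) → Fin b → ℝ), IsOpen B ∧ B.Nonempty ∧
      ∀ w ∈ B, (hankel b (curveForm d w)).det ≠ 0 ∧ curveForm d w ∈ U := by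
  have hd0 : d ≠ 0 := by omega
  obtain ⟨hconn, ⟨O, hO, rfl⟩, n, hn, hsub⟩ := hU
  rw [coneDim_eq hb hd] at hn
  have hn' : (m + 3) * b = n := by exact_mod_cast hn
  have := isPrime_vanishingIdeal_secantCone (m := m + 2) (b := b) hd0
  -- Zariski density, applied to the Hankel determinant: the piece is not contained in its zero
  -- locus.
  obtain ⟨f, hf, hPf⟩ := exists_ne_zero_of_isSubmanifold (V := secantCone (m + 2) d b)
    (fun f hf => hf.1.2) hsub hconn.nonempty (hn' ▸ trdeg_le_secantCone hd0)
    (P := hankelPoly (m + 2) d b) (by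
      intro hP
      have h1 := hP _ (curveForm_mem_secantCone (d := d) hb
        (fun (_ : Fin (m + 2 + 1)) (j : Fin b) => if (j : ℕ) = b - 1 then (1 : ℂ) else 0))
      rw [aeval_hankelPoly] at h1
      exact det_hankel_ne_zero_of_single hb hd (fun j => rfl) h1)
  have hdet : (hankel b f).det ≠ 0 := by
    intro h0
    have := det_hankel_map (b := b) Complex.ofRealHom f
    simp only [Complex.ofRealHom_eq_coe] at this
    rw [aeval_hankelPoly, this, h0] at hPf
    simp at hPf
  obtain ⟨w, rfl⟩ := exists_curveForm_eq_of_mem_realSecant hd hf.1 hdet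
  refine ⟨curveForm d ⁻¹' ({f | (hankel b f).det ≠ 0} ∩ O),
    (isOpen_det_hankel_ne_zero.inter hO).preimage (contDiff_curveForm (𝕜 := ℝ)).continuous,
    ⟨w, hdet, hf.2⟩, fun v hv => ⟨hv.1, curveForm_mem_realSecant hb hv.1, hv.2⟩⟩

/-- Around a parameter with nonsingular Hankel matrix, an open condition on parameters holds on
some full-dimensional piece. -/
theorem exists_isTopPiece (hb : 0 < b) (hd : 2 * b - 1 ≤ d) {w₀ : Fin (m + 2 + 1) → Fin b → ℝ}
    (h₀ : (hankel b (curveForm d w₀)).det ≠ 0) {p : (Fin (m + 2 + 1) → Fin b → ℝ) → Prop}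
    (hp : ∀ᶠ w in 𝓝 w₀, p w) :
    ∃ U : Set (Form ℝ (m + 2) d), IsTopPiece (m + 2) d b U ∧
      ∀ f ∈ U, ∃ w, curveForm d w = f ∧ p w ∧ (hankel b (curveForm d w)).det ≠ 0 := by
  have hdet : ∀ᶠ w in 𝓝 w₀, (hankel b (curveForm d w)).det ≠ 0 :=
    (isOpen_det_hankel_ne_zero.preimage
      (contDiff_curveForm (𝕜 := ℝ) (d := d)).continuous).mem_nhds h₀
  obtain ⟨r, hr, hball⟩ := Metric.eventually_nhds_iff_ball.1 (hp.and hdet)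
  have hB : ∀ w ∈ Metric.ball w₀ r, (hankel b (curveForm d w)).det ≠ 0 := fun w hw => (hball w hw).2
  refine ⟨curveForm d '' Metric.ball w₀ r, ⟨?_, ⟨_, isOpen_chart Metric.isOpen_ball,
    image_curveForm_eq hb hd hB⟩, (m + 3) * b, coneDim_eq hb hd,
    isSubmanifold_image_curveForm hd Metric.isOpen_ball hB⟩, ?_⟩
  · exact (((convex_ball w₀ r).isPreconnected).image _
      (contDiff_curveForm (𝕜 := ℝ)).continuous.continuousOn |> fun h =>
        ⟨(Metric.nonempty_ball.2 hr).image _, h⟩)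
  · rintro _ ⟨w, hw, rfl⟩
    exact ⟨w, rfl, (hball w hw).1, hB w hw⟩

end RealTypicalRank

/-! ### Separating points by products of lines, and the lower bound on the real rank. -/

namespace RealTypicalRank

open Finset MvPolynomial

/-- Some form of degree `n` vanishes on `T` but not at `z`. -/
def Separated {σ : Type} (z : σ → ℂ) (n : ℕ) (T : Set (σ → ℂ)) : Prop :=
  ∃ P : MvPolynomial σ ℂ, P.IsHomogeneous n ∧ eval z P ≠ 0 ∧ ∀ x ∈ T, eval x P = 0

namespace Separated

variable {σ : Type} {z : σ → ℂ}

theorem empty (z : σ → ℂ) : Separated z 0 ∅ :=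
  ⟨1, isHomogeneous_one _ _, by simp, by simp⟩

theorem mul {n k : ℕ} {T S : Set (σ → ℂ)} (hT : Separated z n T) (hS : Separated z k S) :
    Separated z (n + k) (T ∪ S) := by
  obtain ⟨P, hP, hPz, hPT⟩ := hT
  obtain ⟨Q, hQ, hQz, hQS⟩ := hS
  refine ⟨P * Q, hP.mul hQ, by simp [hPz, hQz], ?_⟩
  rintro x (hx | hx)
  · simp [hPT x hx]
  · simp [hQS x hx]

theorem mono_set {n : ℕ} {T S : Set (σ → ℂ)} (hS : Separated z n S) (h : T ⊆ S) :
    Separated z n T := by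
  obtain ⟨P, hP, hPz, hPS⟩ := hS
  exact ⟨P, hP, hPz, fun x hx => hPS x (h hx)⟩

theorem mono {n k : ℕ} {T : Set (σ → ℂ)} (hT : Separated z n T) (hnk : n ≤ k) {i : σ}
    (hi : z i ≠ 0) : Separated z k T := by
  obtain ⟨P, hP, hPz, hPT⟩ := hT
  refine ⟨P * X i ^ (k - n), ?_, by simp [hPz, hi], fun x hx => by simp [hPT x hx]⟩
  have := hP.mul ((isHomogeneous_X ℂ i).pow (k - n))
  rwa [one_mul, Nat.add_sub_cancel' hnk] at this

theorem of_notMem_span [Fintype σ] {S : Submodule ℂ (σ → ℂ)} (h : z ∉ S) :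
    Separated z 1 (S : Set (σ → ℂ)) := by
  classical
  obtain ⟨f, hf, hS⟩ := Submodule.exists_dual_map_eq_bot_of_notMem h inferInstance
  have hev : ∀ x, eval x (∑ i, C (f (Pi.single i 1)) * X i) = f x := by
    intro x
    conv_rhs => rw [← Finset.univ_sum_single x]
    rw [map_sum, map_sum]
    refine Finset.sum_congr rfl fun i _ => ?_
    have : (Pi.single i (x i) : σ → ℂ) = x i • Pi.single i 1 := by
      rw [← Pi.single_smul]
      simp
    rw [this, map_smul]
    simp [mul_comm]
  refine ⟨∑ i, C (f (Pi.single i 1)) * X i, ?_, by rwa [hev], fun x hx => ?_⟩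
  · exact IsHomogeneous.sum _ _ _ fun i _ => (isHomogeneous_C_mul_X _ _)
  · rw [hev]
    have : f x ∈ S.map f := ⟨x, hx, rfl⟩
    rw [hS] at this
    simpa using this

theorem pair [Fintype σ] {p q : σ → ℂ} (h : z ∉ Submodule.span ℂ {p, q}) :
    Separated z 1 {p, q} :=
  (of_notMem_span h).mono_set Submodule.subset_span

theorem singles [Fintype σ] (l : List (σ → ℂ)) (h : ∀ p ∈ l, z ∉ Submodule.span ℂ {p, p}) :
    Separated z l.length {x | x ∈ l} := by
  induction l with
  | nil => exact (empty z).mono_set (by simp)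
  | cons p l ih =>
    refine ((ih fun q hq => h q (by simp [hq])).mul (pair (h p (by simp)))).mono_set ?_
    intro x hx
    simp only [Set.mem_ofPred_eq, List.mem_cons] at hx
    rcases hx with rfl | hx
    · simp
    · exact Or.inl hx

theorem pairs [Fintype σ] : ∀ l : List (σ → ℂ), (∀ p ∈ l, ∀ q ∈ l, z ∉ Submodule.span ℂ {p, q}) →
    Separated z ((l.length + 1) / 2) {x | x ∈ l}
  | [], _ => by simpa using empty z
  | [p], h => by simpa using singles [p] (by simpa using h)
  | p :: q :: l, h => by
    have ih := pairs l fun p hp q hq => h p (by simp [hp]) q (by simp [hq])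
    have := ih.mul (pair (h p (by simp) q (by simp)))
    have hlen : ((p :: q :: l).length + 1) / 2 = (l.length + 1) / 2 + 1 := by
      simp only [List.length_cons]
      omega
    rw [hlen]
    refine this.mono_set ?_
    intro x hx
    simp only [Set.mem_ofPred_eq, List.mem_cons] at hx
    rcases hx with rfl | rfl | hx
    · simp
    · simp
    · exact Or.inl hx

/-- Each point of `A` shares a line with a point of `B` or `C` while any is left; the remaining
points are paired inside `B` and inside `C`. Lines joining `B` to `C` are avoided, as they may pass
through `z`. The summand 2 pays for two odd leftovers. -/
theorem three_lists [Fintype σ] {i : σ} (hi : z i ≠ 0) : ∀ (A B C : List (σ → ℂ)) (n : ℕ),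
    (∀ p ∈ A, z ∉ Submodule.span ℂ {p, p}) →
    (∀ p ∈ A, ∀ q ∈ B, z ∉ Submodule.span ℂ {p, q}) →
    (∀ p ∈ A, ∀ q ∈ C, z ∉ Submodule.span ℂ {p, q}) →
    (∀ p ∈ B, ∀ q ∈ B, z ∉ Submodule.span ℂ {p, q}) →
    (∀ p ∈ C, ∀ q ∈ C, z ∉ Submodule.span ℂ {p, q}) →
    A.length ≤ n → A.length + B.length + C.length + 2 ≤ 2 * n →
    Separated z n {x | x ∈ A ∨ x ∈ B ∨ x ∈ C}
  | [], B, C, n, _, _, _, hB, hC, _, hn => by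
    refine (((pairs B hB).mul (pairs C hC)).mono ?_ hi).mono_set ?_
    · simp only [List.length_nil] at hn
      omega
    · intro x hx
      simpa using hx
  | p :: A, q :: B, C, n, hA, hAB, hAC, hB, hC, hn, hn' => by
    simp only [List.length_cons] at hn hn'
    obtain ⟨k, rfl⟩ : ∃ k, n = k + 1 := ⟨n - 1, by omega⟩
    have ih := three_lists hi A B C k (fun p hp => hA p (by simp [hp]))
      (fun p hp q hq => hAB p (by simp [hp]) q (by simp [hq]))
      (fun p hp q hq => hAC p (by simp [hp]) q hq)
      (fun p hp q hq => hB p (by simp [hp]) q (by simp [hq])) hC (by omega) (by omega)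
    refine (ih.mul (pair (hAB p (by simp) q (by simp)))).mono_set ?_
    intro x hx
    simp only [Set.mem_ofPred_eq, List.mem_cons, Set.mem_union, Set.mem_insert_iff,
      Set.mem_singleton_iff] at hx ⊢
    tauto
  | p :: A, [], q :: C, n, hA, hAB, hAC, hB, hC, hn, hn' => by
    simp only [List.length_cons, List.length_nil] at hn hn'
    obtain ⟨k, rfl⟩ : ∃ k, n = k + 1 := ⟨n - 1, by omega⟩
    have ih := three_lists hi A [] C k (fun p hp => hA p (by simp [hp])) (by simp)
      (fun p hp q hq => hAC p (by simp [hp]) q (by simp [hq])) (by simp)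
      (fun p hp q hq => hC p (by simp [hp]) q (by simp [hq])) (by omega)
      (by simp only [List.length_nil]; omega)
    refine (ih.mul (pair (hAC p (by simp) q (by simp)))).mono_set ?_
    intro x hx
    simp only [Set.mem_ofPred_eq, List.mem_cons, Set.mem_union, Set.mem_insert_iff,
      Set.mem_singleton_iff] at hx ⊢
    tauto
  | p :: A, [], [], n, hA, _, _, _, _, hn, _ => by
    refine ((singles (p :: A) hA).mono hn hi).mono_set ?_
    intro x hx
    simpa using hx

end Separated

theorem mem_span_pair_self {σ : Type} {p x : σ → ℂ} (h : x ∈ Submodule.span ℂ {p, p}) :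
    ∃ α : ℂ, x = α • p := by
  rw [Set.pair_eq_singleton, Submodule.mem_span_singleton] at h
  obtain ⟨α, rfl⟩ := h
  exact ⟨α, rfl⟩

section LowerBound

variable {b s d : ℕ} {c : Fin b → ℂ} {z : Fin b → Fin 3 → ℂ} {r : Fin s → ℂ}
  {a : Fin s → Fin 3 → ℂ}

/-- If some point is not real, and no three points are collinear, then a real decomposition has
at least `b + d - 2` summands. -/
theorem le_card_of_relation (hb : 2 ≤ b) (hd : 2 * b - 1 ≤ d) (hc : ∀ i, c i ≠ 0)
    (hz0 : ∀ i, z i 0 = 1) (hz : Function.Injective z)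
    (hcol : ∀ i j k, i ≠ j → i ≠ k → j ≠ k → z i ∉ Submodule.span ℂ {z j, z k})
    {i₀ i₁ : Fin b} (hne : i₀ ≠ i₁) (hconj : z i₁ = star (z i₀)) (ha : ∀ j, star (a j) = a j)
    (hrel : ∀ P : MvPolynomial (Fin 3) ℂ, P.IsHomogeneous d →
      ∑ i, c i * eval (z i) P = ∑ j, r j * eval (a j) P) : b + d - 2 ≤ s := by
  classical
  by_contra! hlt
  set Λ := Submodule.span ℂ {z i₀, z i₁} with hΛ
  have hsingle : ∀ i j (α : ℂ), z i = α • z j → i = j := by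
    intro i j α h
    have h0 := congrFun h 0
    simp only [hz0, Pi.smul_apply, smul_eq_mul, mul_one] at h0
    rw [← h0, one_smul] at h
    exact hz h
  have hnonreal : ∀ j (α : ℂ), z i₀ ≠ α • a j := by
    intro j α h
    have h0 := congrFun h 0
    have h0' := congrArg star h0
    have hj0 : star (a j 0) = a j 0 := congrFun (ha j) 0
    simp only [hz0, Pi.smul_apply, smul_eq_mul, star_mul', star_one, hj0] at h0 h0'
    have hα : star α = α := mul_right_cancel₀ (right_ne_zero_of_mul (h0 ▸ one_ne_zero))
      (h0'.symm.trans h0)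
    refine hne (hz ?_)
    rw [hconj, h, star_smul, ha, hα]
  have hoff : ∀ i, i ≠ i₀ → i ≠ i₁ → z i ∉ Λ := fun i h0 h1 => hcol i i₀ i₁ h0 h1 hne
  -- A separating form of degree `d` would reduce the relation to `c i * P(z i) = 0`.
  have hsep : ∀ i, ¬ Separated (z i) d ({x | ∃ i', i' ≠ i ∧ x = z i'} ∪ Set.range a) := by
    rintro i ⟨P, hP, hPz, hPT⟩
    have := hrel P hP
    rw [Finset.sum_eq_single i, Finset.sum_eq_zero] at this
    · exact (mul_ne_zero (hc i) hPz) this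
    · intro j _
      rw [hPT _ (Or.inr ⟨j, rfl⟩), mul_zero]
    · intro i' _ hi'
      rw [hPT _ (Or.inl ⟨i', hi', rfl⟩), mul_zero]
    · simp
  set On := univ.filter fun j => a j ∈ Λ with hOn
  set Off := univ.filter fun j => a j ∉ Λ with hOff
  set Z := univ.filter fun i => i ≠ i₀ ∧ i ≠ i₁ with hZ
  have hcard : On.card + Off.card = s := by
    have := Finset.card_filter_add_card_filter_not (s := (univ : Finset (Fin s))) fun j => a j ∈ Λ
    simpa using this
  have hZcard : Z.card + 2 = b := by
    have h1 : Z = (univ.erase i₀).erase i₁ := by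
      ext i
      simp [hZ, and_comm]
    rw [h1, Finset.card_erase_of_mem (by simp [hne.symm]), Finset.card_erase_of_mem (by simp)]
    simp
    omega
  rcases le_or_gt d On.card with hk | hk
  -- At least `d` real points lie on the line `Λ` of the conjugate pair. Then each of the `b - 2`
  -- points `z i` off `Λ` must be proportional to a real point off `Λ`, which gives `d + (b - 2)`
  -- real points in all.
  · have hex : ∀ i : Z, ∃ j ∈ Off, z i ∈ Submodule.span ℂ {a j, a j} := by
      rintro ⟨i, hi⟩
      have hi' := hi
      simp only [hZ, mem_filter, mem_univ, true_and] at hi'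
      by_contra! hcon
      have h1 : Separated (z i) 1 (Λ : Set (Fin 3 → ℂ)) :=
        Separated.of_notMem_span (hoff i hi'.1 hi'.2)
      have h2 := Separated.singles (z := z i) ((Z.erase i).toList.map z) (by
        intro p hp hmem
        simp only [List.mem_map, mem_toList, mem_erase] at hp
        obtain ⟨i', hi', rfl⟩ := hp
        obtain ⟨α, hα⟩ := mem_span_pair_self hmem
        exact hi'.1 (hsingle _ _ _ hα).symm)
      have h3 := Separated.singles (z := z i) (Off.toList.map a) (by
        intro p hp
        simp only [List.mem_map, mem_toList] at hp
        obtain ⟨j, hj, rfl⟩ := hp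
        exact hcon j hj)
      -- The degree is `1 + (b - 3) + Off.card`, and `Off.card ≤ b - 3` under the assumption on `s`.
      refine hsep i ((((h1.mul h2).mul h3).mono (k := d) ?_ (i := 0) (by simp [hz0])).mono_set ?_)
      · rw [List.length_map, List.length_map, length_toList, length_toList,
          Finset.card_erase_of_mem hi]
        omega
      · rintro x (⟨i', hi', rfl⟩ | ⟨j, rfl⟩)
        · refine Or.inl ?_
          by_cases h0 : i' = i₀
          · exact Or.inl (h0 ▸ Submodule.subset_span (by simp))
          by_cases h1 : i' = i₁
          · exact Or.inl (h1 ▸ Submodule.subset_span (by simp))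
          · right
            simp only [Set.mem_ofPred_eq, List.mem_map, mem_toList, mem_erase]
            exact ⟨i', ⟨hi', by simp [hZ, h0, h1]⟩, rfl⟩
        · by_cases hj : a j ∈ Λ
          · exact Or.inl (Or.inl hj)
          · right
            simp only [Set.mem_ofPred_eq, List.mem_map, mem_toList]
            exact ⟨j, by simp [hOff, hj], rfl⟩
    choose J hJ hJz using hex
    have hinj : Function.Injective J := by
      intro i i' h
      obtain ⟨α, hα⟩ := mem_span_pair_self (hJz i)
      obtain ⟨β, hβ⟩ := mem_span_pair_self (hJz i')
      have h0 := congrFun hα 0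
      have h0' := congrFun hβ 0
      rw [h] at hα h0
      simp only [hz0, Pi.smul_apply, smul_eq_mul] at h0 h0'
      have hαβ : α = β := mul_right_cancel₀ (right_ne_zero_of_mul (h0 ▸ one_ne_zero))
        (h0.symm.trans h0')
      exact Subtype.ext (hz (by rw [hα, hβ, hαβ]))
    have : Z.card ≤ Off.card := by
      have := Finset.card_le_card_of_injOn (s := (univ : Finset Z)) (t := Off) J
        (fun i _ => hJ i) hinj.injOn
      simpa using this
    omega
  -- Fewer than `d` real points lie on `Λ`, and `z i₀` itself gets separated. A line through a point
  -- of `Λ` and a point off `Λ` meets `Λ` only in the former, which is real and so differs from `z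
  -- i₀`.
  · have hon : ∀ j, a j ∈ Λ → ∀ q, q ∉ Λ → z i₀ ∉ Submodule.span ℂ {a j, q} := by
      intro j hj q hq hmem
      obtain ⟨α, β, h⟩ := Submodule.mem_span_pair.1 hmem
      by_cases hβ : β = 0
      · rw [hβ, zero_smul, add_zero] at h
        exact hnonreal j α h.symm
      · refine hq ?_
        have : q = β⁻¹ • (z i₀ - α • a j) := by
          rw [← h, add_sub_cancel_left, smul_smul, inv_mul_cancel₀ hβ, one_smul]
        rw [this]
        exact Λ.smul_mem _ (Λ.sub_mem (Submodule.subset_span (by simp)) (Λ.smul_mem _ hj))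
    have hself : ∀ j, z i₀ ∉ Submodule.span ℂ {a j, a j} := fun j hmem => by
      obtain ⟨α, hα⟩ := mem_span_pair_self hmem
      exact hnonreal j α hα
    -- A line through two real points that contains `z i₀` also contains its conjugate, hence would
    -- be `Λ`.
    have hreal : ∀ j, a j ∉ Λ → ∀ j', z i₀ ∉ Submodule.span ℂ {a j, a j'} := by
      intro j hj j' hmem
      obtain ⟨α, β, h⟩ := Submodule.mem_span_pair.1 hmem
      have h' : star α • a j + star β • a j' = z i₁ := by
        rw [hconj, ← h, star_add, star_smul, star_smul, ha, ha]
      have hD : (α * star β - β * star α) • a j = star β • z i₀ - β • z i₁ := by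
        rw [← h, ← h']
        ext k
        simp only [Pi.smul_apply, Pi.sub_apply, Pi.add_apply, smul_eq_mul]
        ring
      by_cases hD0 : α * star β - β * star α = 0
      · rw [hD0, zero_smul] at hD
        have h0 := congrFun hD 0
        simp only [Pi.zero_apply, Pi.sub_apply, Pi.smul_apply, hz0, smul_eq_mul, mul_one] at h0
        have hββ : star β = β := (sub_eq_zero.1 h0.symm)
        by_cases hβ : β = 0
        · rw [hβ, zero_smul, add_zero] at h
          exact hnonreal j α h.symm
        · rw [hββ, ← smul_sub] at hD
          have := (smul_eq_zero.1 hD.symm).resolve_left hβ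
          exact hne (hz (sub_eq_zero.1 this))
      · refine hj ?_
        have : a j = (α * star β - β * star α)⁻¹ • (star β • z i₀ - β • z i₁) := by
          rw [← hD, smul_smul, inv_mul_cancel₀ hD0, one_smul]
        rw [this]
        exact Λ.smul_mem _ (Λ.sub_mem (Λ.smul_mem _ (Submodule.subset_span (by simp)))
          (Λ.smul_mem _ (Submodule.subset_span (by simp))))
    -- Degree `d - 1`, since one linear factor is reserved for `z i₁`.
    have h1 := Separated.three_lists (z := z i₀) (i := 0) (by simp [hz0]) (On.toList.map a)
      (Off.toList.map a) (Z.toList.map z) (d - 1)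
      (by
        intro p hp
        simp only [List.mem_map, mem_toList] at hp
        obtain ⟨j, hj, rfl⟩ := hp
        exact hself j)
      (by
        intro p hp q hq
        simp only [List.mem_map, mem_toList, hOn, hOff, mem_filter, mem_univ, true_and] at hp hq
        obtain ⟨j, hj, rfl⟩ := hp
        obtain ⟨j', hj', rfl⟩ := hq
        exact hon j hj _ hj')
      (by
        intro p hp q hq
        simp only [List.mem_map, mem_toList, hOn, hZ, mem_filter, mem_univ, true_and] at hp hq
        obtain ⟨j, hj, rfl⟩ := hp
        obtain ⟨i, hi, rfl⟩ := hq
        exact hon j hj _ (hoff i hi.1 hi.2))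
      (by
        intro p hp q hq
        simp only [List.mem_map, mem_toList, hOff, mem_filter, mem_univ, true_and] at hp hq
        obtain ⟨j, hj, rfl⟩ := hp
        obtain ⟨j', hj', rfl⟩ := hq
        exact hreal j hj j')
      (by
        intro p hp q hq
        simp only [List.mem_map, mem_toList, hZ, mem_filter, mem_univ, true_and] at hp hq
        obtain ⟨i, hi, rfl⟩ := hp
        obtain ⟨i', hi', rfl⟩ := hq
        by_cases hii : i = i'
        · subst hii
          intro hmem
          obtain ⟨α, hα⟩ := mem_span_pair_self hmem
          exact hi.1 (hsingle _ _ _ hα).symm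
        · exact hcol i₀ i i' hi.1.symm hi'.1.symm hii)
      (by rw [List.length_map, length_toList]; omega)
      -- There are `s + (b - 2)` points and `s ≤ b + d - 3`, so the inequality needed is exactly `2b
      -- - 1 ≤ d`.
      (by simp only [List.length_map, length_toList]; omega)
    have h2 : Separated (z i₀) 1 {z i₁, z i₁} := Separated.pair fun hmem => by
      obtain ⟨α, hα⟩ := mem_span_pair_self hmem
      exact hne (hsingle _ _ _ hα)
    have h3 := h1.mul h2
    rw [Nat.sub_add_cancel (by omega)] at h3
    refine hsep i₀ (h3.mono_set ?_)
    rintro x (⟨i', hi', rfl⟩ | ⟨j, rfl⟩)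
    · by_cases h1 : i' = i₁
      · right; simp [h1]
      · left; right; right
        simp only [List.mem_map, mem_toList]
        exact ⟨i', by simp [hZ, hi', h1], rfl⟩
    · left
      by_cases hj : a j ∈ Λ
      · left
        simp only [List.mem_map, mem_toList]
        exact ⟨j, by simp [hOn, hj], rfl⟩
      · right; left
        simp only [List.mem_map, mem_toList]
        exact ⟨j, by simp [hOff, hj], rfl⟩

end LowerBound

end RealTypicalRank

/-! ### Real decompositions of a conjugate pair, and parameters with one pair of non-real roots. -/

namespace RealTypicalRank

open Finset MvPolynomial

section SumOfPowers

/-- A combination of the `d`-th powers of two conjugate elements, written with `d` powers of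
elements of the form `ω A + conj ω B`. -/
theorem sum_pow_eq_add_conj_pow {d : ℕ} (hd : d ≠ 0) (c : ℂ) :
    ∃ ω : Fin d → ℂ, ∀ {A : Type} [CommRing A] [Algebra ℂ A] (x y : A),
      ∑ j : Fin d, algebraMap ℂ A ((-1) ^ (j : ℕ)) *
          (algebraMap ℂ A (ω j) * x + algebraMap ℂ A (star (ω j)) * y) ^ d =
        algebraMap ℂ A c * x ^ d + algebraMap ℂ A (star c) * y ^ d := by
  -- Each of the two surviving binomial terms is counted `d` times, hence the division by `d`.
  obtain ⟨ω, hω⟩ := IsAlgClosed.exists_pow_nat_eq (c / d) (Nat.pos_of_ne_zero hd)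
  have hdC : (d : ℂ) ≠ 0 := Nat.cast_ne_zero.2 hd
  set ξ : ℂ := Complex.exp (Real.pi / d * Complex.I) with hξ
  have hξd : ξ ^ d = -1 := by
    rw [hξ, ← Complex.exp_nat_mul, ← mul_assoc, mul_div_cancel₀ _ hdC, Complex.exp_pi_mul_I]
  have hη : IsPrimitiveRoot (ξ ^ 2) d := by
    have := Complex.isPrimitiveRoot_exp d hd
    rwa [show ξ ^ 2 = Complex.exp (2 * Real.pi * Complex.I / d) by
      rw [hξ, ← Complex.exp_nat_mul]; congr 1; push_cast; ring]
  have hξξ : ξ * star ξ = 1 := by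
    change ξ * (starRingEnd ℂ) ξ = 1
    rw [Complex.mul_conj, Complex.normSq_eq_norm_sq, hξ,
      show (Real.pi / d * Complex.I : ℂ) = ((Real.pi / d : ℝ) : ℂ) * Complex.I by push_cast; rfl,
      Complex.norm_exp_ofReal_mul_I]
    simp
  -- Roots-of-unity filter: of the binomial terms only `k = 0` and `k = d` survive.
  have hgeom : ∀ k ≤ d, ∑ j : Fin d, (((ξ ^ 2) ^ k) ^ (j : ℕ)) =
      if k = 0 ∨ k = d then (d : ℂ) else 0 := by
    intro k hk
    rw [Fin.sum_univ_eq_sum_range fun j => ((ξ ^ 2) ^ k) ^ j]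
    split_ifs with h
    · have : (ξ ^ 2) ^ k = 1 := by
        rcases h with rfl | rfl
        · simp
        · exact hη.pow_eq_one
      simp [this]
    · push Not at h
      have h1 : (ξ ^ 2) ^ k ≠ 1 := hη.pow_ne_one_of_pos_of_lt h.1 (lt_of_le_of_ne hk h.2)
      have h2 := mul_neg_geom_sum ((ξ ^ 2) ^ k) d
      have h3 : ((ξ ^ 2) ^ k) ^ d = 1 := by
        rw [← pow_mul, mul_comm, pow_mul, hη.pow_eq_one, one_pow]
      rw [h3, sub_self] at h2
      exact (mul_eq_zero.1 h2).resolve_left (sub_ne_zero.2 h1.symm)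
  refine ⟨fun j => ω * ξ ^ (j : ℕ), fun {A} _ _ x y => ?_⟩
  -- The sign is `(-1) ^ j = ξ ^ (d * j)`; with `ξ * star ξ = 1` it turns the phase into a power of
  -- the primitive root `ξ ^ 2`.
  have hterm : ∀ k ≤ d, ∀ j : Fin d,
      (-1 : ℂ) ^ (j : ℕ) * ((ω * ξ ^ (j : ℕ)) ^ k * star (ω * ξ ^ (j : ℕ)) ^ (d - k)) =
        ω ^ k * star ω ^ (d - k) * ((ξ ^ 2) ^ k) ^ (j : ℕ) := by
    intro k hk j
    have h1 : (-1 : ℂ) * (ξ ^ k * star ξ ^ (d - k)) = (ξ ^ 2) ^ k := by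
      obtain ⟨l, rfl⟩ := Nat.exists_eq_add_of_le hk
      rw [← hξd, Nat.add_sub_cancel_left]
      calc ξ ^ (k + l) * (ξ ^ k * star ξ ^ l) = (ξ ^ 2) ^ k * (ξ * star ξ) ^ l := by ring
        _ = _ := by rw [hξξ, one_pow, mul_one]
    rw [← h1]
    simp only [star_mul', star_pow]
    ring
  calc ∑ j : Fin d, algebraMap ℂ A ((-1) ^ (j : ℕ)) * (algebraMap ℂ A (ω * ξ ^ (j : ℕ)) * x +
          algebraMap ℂ A (star (ω * ξ ^ (j : ℕ))) * y) ^ d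
      = ∑ j : Fin d, ∑ k ∈ range (d + 1), algebraMap ℂ A (ω ^ k * star ω ^ (d - k) *
          ((ξ ^ 2) ^ k) ^ (j : ℕ)) * (x ^ k * y ^ (d - k) * (d.choose k : A)) := by
        refine Finset.sum_congr rfl fun j _ => ?_
        rw [add_pow, Finset.mul_sum]
        refine Finset.sum_congr rfl fun k hk => ?_
        rw [← hterm k (by simpa [Nat.lt_succ_iff] using hk) j]
        simp only [map_mul, map_pow]
        ring
    _ = ∑ k ∈ range (d + 1), algebraMap ℂ A (ω ^ k * star ω ^ (d - k) *
          if k = 0 ∨ k = d then (d : ℂ) else 0) * (x ^ k * y ^ (d - k) * (d.choose k : A)) := by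
        rw [Finset.sum_comm]
        refine Finset.sum_congr rfl fun k hk => ?_
        rw [← Finset.sum_mul, ← map_sum, ← Finset.mul_sum,
          hgeom k (by simpa [Nat.lt_succ_iff] using hk)]
    _ = algebraMap ℂ A c * x ^ d + algebraMap ℂ A (star c) * y ^ d := by
        have h2 : star ω ^ d * d = star c := by
          rw [← star_pow, hω, star_div₀, star_natCast, div_mul_cancel₀ _ hdC]
        have h1 : ω ^ d * d = c := by rw [hω, div_mul_cancel₀ _ hdC]
        rw [← Finset.sum_subset (s₁ := {0, d})]
        · rw [Finset.sum_pair hd.symm]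
          rw [if_pos (Or.inl rfl), if_pos (Or.inr rfl)]
          simp only [pow_zero, one_mul, Nat.sub_zero, Nat.sub_self, mul_one,
            Nat.choose_zero_right, Nat.choose_self, Nat.cast_one, h1, h2]
          ring
        · intro k hk
          simp only [mem_insert, mem_singleton] at hk
          rcases hk with rfl | rfl <;> simp
        · intro k _ hk
          simp only [mem_insert, mem_singleton] at hk
          simp [hk]

variable {m d : ℕ}

theorem powForm_map {K L : Type} [Field K] [Field L] (φ : K →+* L) (a : Fin (m + 1) → K) :
    powForm d (fun k => φ (a k)) = fun e => φ (powForm d a e) := by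
  funext e
  simp [powForm, mult]

theorem ofReal_sum_smul_powForm {ι : Type} [Fintype ι] (r : ι → ℝ) (a : ι → Fin (m + 1) → ℝ) :
    (fun e => (((∑ i, r i • powForm d (a i) : Form ℝ m d) e : ℝ) : ℂ)) =
      ∑ i, (r i : ℂ) • powForm d (fun k => (a i k : ℂ)) := by
  have h := fun i => powForm_map (d := d) Complex.ofRealHom (a i)
  simp only [Complex.ofRealHom_eq_coe] at h
  funext e
  simp [Finset.sum_apply, h]

theorem linForm_combination {K : Type} [Field K] (α β : K) (p q : Fin (m + 1) → K) :
    linForm (fun k => α * p k + β * q k) = C α * linForm p + C β * linForm q := by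
  simp only [linForm, Finset.mul_sum, ← Finset.sum_add_distrib]
  refine Finset.sum_congr rfl fun i _ => ?_
  simp only [map_add, map_mul]
  ring

/-- For conjugate linear forms, `ω ℓ` plus its conjugate is twice a real part, so all `d` summands
are real. -/
theorem exists_real_decomposition_pair (hd : d ≠ 0) (c : ℂ) (q : Fin (m + 1) → ℂ) :
    ∃ (r : Fin d → ℝ) (a : Fin d → Fin (m + 1) → ℝ),
      ∑ j, (r j : ℂ) • powForm d (fun k => (a j k : ℂ)) =
        c • powForm d q + star c • powForm d (star q) := by
  obtain ⟨ω, hω⟩ := sum_pow_eq_add_conj_pow hd c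
  refine ⟨fun j => (-1) ^ (j : ℕ), fun j k => 2 * (ω j * q k).re, poly_injective ?_⟩
  have h1 : poly (c • powForm d q + star c • powForm d (star q)) =
      C c * linForm q ^ d + C (star c) * linForm (star q) ^ d := by
    have := poly_sum_smul (univ : Finset (Fin 2)) ![c, star c] ![powForm d q, powForm d (star q)]
    simpa [Fin.sum_univ_two, poly_powForm] using this
  rw [h1, poly_sum_smul]
  refine Eq.trans ?_ (hω (A := MvPolynomial (Fin (m + 1)) ℂ) (linForm q) (linForm (star q)))
  refine Finset.sum_congr rfl fun j _ => ?_
  have h2 : (fun k => ((2 * (ω j * q k).re : ℝ) : ℂ)) =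
      fun k => ω j * q k + star (ω j) * star q k := by
    funext k
    have := Complex.add_conj (ω j * q k)
    rw [← this]
    simp
  rw [poly_powForm, h2, linForm_combination, MvPolynomial.algebraMap_eq]
  simp

end SumOfPowers

section RealCurves

variable {m b d : ℕ}

/-- A real parameter regarded as a complex one. -/
def complexify (w : Fin (m + 1) → Fin b → ℝ) : Fin (m + 1) → Fin b → ℂ := fun k j => (w k j : ℂ)

theorem complexify_eq (w : Fin (m + 1) → Fin b → ℝ) :
    complexify w = fun k j => Complex.ofRealHom (w k j) := rfl

theorem curveForm_complexify (w : Fin (m + 1) → Fin b → ℝ) :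
    curveForm d (complexify w) = fun e => ((curveForm d w e : ℝ) : ℂ) :=
  curveForm_map Complex.ofRealHom w

theorem det_hankel_complexify {w : Fin (m + 1) → Fin b → ℝ}
    (h : (hankel b (curveForm d w)).det ≠ 0) :
    (hankel b (curveForm d (complexify w))).det ≠ 0 := by
  have := det_hankel_map (b := b) Complex.ofRealHom (curveForm d w)
  rw [curveForm_complexify]
  simp only [Complex.ofRealHom_eq_coe] at this
  rw [this]
  exact_mod_cast h

theorem eval_star_map_ofReal (p : Polynomial ℝ) (z : ℂ) :
    (p.map Complex.ofRealHom).eval (star z) = star ((p.map Complex.ofRealHom).eval z) := by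
  have h := Polynomial.hom_eval₂ p Complex.ofRealHom (starRingEnd ℂ) z
  have h2 : (starRingEnd ℂ).comp Complex.ofRealHom = Complex.ofRealHom := by
    ext x
    simp
  rw [h2] at h
  rw [Polynomial.eval_map, Polynomial.eval_map]
  exact h.symm

theorem eval_recPoly_complexify_star {w : Fin (m + 1) → Fin b → ℝ} {z : ℂ}
    (h : (recPoly (complexify w)).eval z = 0) : (recPoly (complexify w)).eval (star z) = 0 := by
  rw [complexify_eq, recPoly_map] at h ⊢
  rw [eval_star_map_ofReal, h, star_zero]

theorem eval_curveCoord_complexify_star (w : Fin (m + 1) → Fin b → ℝ) (k : Fin (m + 1)) (z : ℂ) :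
    (curveCoord (complexify w) k).eval (star z) =
      star ((curveCoord (complexify w) k).eval z) := by
  rw [complexify_eq, curveCoord_map, eval_star_map_ofReal]

theorem eval_curveCoord_complexify_ofReal (w : Fin (m + 1) → Fin b → ℝ) (k : Fin (m + 1)) (x : ℝ) :
    (curveCoord (complexify w) k).eval (x : ℂ) = (((curveCoord w k).eval x : ℝ) : ℂ) := by
  rw [complexify_eq, curveCoord_map, Polynomial.eval_map]
  exact Polynomial.eval₂_at_apply Complex.ofRealHom x

/-- The curve points of the roots have no three collinear projections to the first three
coordinates. -/
def NoThreeCollinear (w : Fin (m + 2 + 1) → Fin b → ℝ) : Prop :=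
  ∀ x y z : ℂ, (recPoly (complexify w)).eval x = 0 → (recPoly (complexify w)).eval y = 0 →
    (recPoly (complexify w)).eval z = 0 → x ≠ y → x ≠ z → y ≠ z →
    (z - x) * ((curveCoord (complexify w) 2).eval y - (curveCoord (complexify w) 2).eval x) ≠
      (y - x) * ((curveCoord (complexify w) 2).eval z - (curveCoord (complexify w) 2).eval x)

/-- Test polynomials in `x_0, x_1, x_2` alone reduce the bound to plane points; the Hankel condition
makes all complex coefficients nonzero. -/
theorem le_of_isSumOfPowers_curveForm (hb : 2 ≤ b) (hd : 2 * b - 1 ≤ d)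
    {w : Fin (m + 2 + 1) → Fin b → ℝ} (hw : (hankel b (curveForm d w)).det ≠ 0)
    (hsep : (recPoly (complexify w)).Separable) (hcol : NoThreeCollinear w) {ζ : ℂ}
    (hζ : (recPoly (complexify w)).eval ζ = 0) (hζ' : star ζ ≠ ζ) {s : ℕ}
    (hs : IsSumOfPowers s (curveForm d w)) : b + d - 2 ≤ s := by
  obtain ⟨t, hinj, ht, hsurj⟩ := exists_roots_of_separable hsep (natDegree_recPoly _)
  obtain ⟨c, hc⟩ := exists_coeff_of_roots hinj ht
  obtain ⟨i₀, rfl⟩ := hsurj ζ hζ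
  obtain ⟨i₁, hi₁⟩ := hsurj _ (eval_recPoly_complexify_star hζ)
  obtain ⟨r, a, hra⟩ := isSumOfPowers_iff.1 hs
  have hsum := curveForm_eq_sum (d := d) hc
  have hc0 : ∀ i, c i ≠ 0 :=
    (ne_zero_of_det_hankel_ne_zero hd (hsum ▸ det_hankel_complexify hw)).1
  have heq : ∑ i, c i • powForm d (fun k => (curveCoord (complexify w) k).eval (t i)) =
      ∑ j, (r j : ℂ) • powForm d (fun k => (a j k : ℂ)) := by
    rw [← hsum, curveForm_complexify, ← ofReal_sum_smul_powForm, hra]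
  let ι : Fin 3 → Fin (m + 2 + 1) := Fin.castLE (by omega)
  have hι0 : ι 0 = 0 := rfl
  have hι1 : ι 1 = 1 := rfl
  have hι2 : ι 2 = 2 := rfl
  refine le_card_of_relation hb hd hc0 (z := fun i l => (curveCoord (complexify w) (ι l)).eval (t i))
    (a := fun j l => (a j (ι l) : ℂ)) (r := fun j => (r j : ℂ)) (i₀ := i₀) (i₁ := i₁)
    ?_ ?_ ?_ ?_ ?_ ?_ ?_
  · intro i
    simp [hι0, curveCoord_zero]
  · intro i j hij
    have := congrFun hij 1
    simp only [hι1, curveCoord_one, Polynomial.eval_X] at this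
    exact hinj this
  · intro i j k hij hik hjk hmem
    obtain ⟨α, β, h⟩ := Submodule.mem_span_pair.1 hmem
    have h0 := congrFun h 0
    have h1 := congrFun h 1
    have h2 := congrFun h 2
    simp only [Pi.add_apply, Pi.smul_apply, smul_eq_mul, hι0, hι1, hι2, curveCoord_zero,
      curveCoord_one, Polynomial.eval_one, Polynomial.eval_X, mul_one] at h0 h1 h2
    refine hcol (t j) (t i) (t k) (ht j) (ht i) (ht k) (hinj.ne hij.symm) (hinj.ne hjk)
      (hinj.ne hik) ?_
    have hα : α = 1 - β := by rw [← h0]; ring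
    have h1' : t i = (1 - β) * t j + β * t k := by rw [← hα, h1]
    rw [← h2, hα, h1']
    ring
  · rintro rfl
    exact hζ' hi₁.symm
  · funext l
    simp only [hi₁, eval_curveCoord_complexify_star, Pi.star_apply]
  · intro j
    funext l
    simp
  · intro P hP
    have := sum_mul_eval_eq heq (hP.rename_isHomogeneous (f := ι))
    simpa [eval_rename, Function.comp_def] using this

theorem isSumOfPowers_of_real_roots {w : Fin (m + 1) → Fin b → ℝ} {τ : Fin b → ℝ}
    (hinj : Function.Injective τ) (hτ : ∀ i, (recPoly w).eval (τ i) = 0) :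
    IsSumOfPowers b (curveForm d w) := by
  obtain ⟨c, hc⟩ := exists_coeff_of_roots hinj hτ
  exact isSumOfPowers_iff.2 ⟨_, _, curveForm_eq_sum hc⟩

theorem coeff_unique {t c c' : Fin b → ℂ} (hinj : Function.Injective t)
    (h : ∀ j : Fin b, ∑ i, c i * t i ^ (j : ℕ) = ∑ i, c' i * t i ^ (j : ℕ)) : c = c' := by
  have hV := Matrix.det_vandermonde_ne_zero_iff.2 hinj
  have : Matrix.vecMul (c - c') (Matrix.vandermonde t) = 0 := by
    funext j
    simp [Matrix.vecMul, dotProduct, sub_mul, Finset.sum_sub_distrib, h]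
  exact sub_eq_zero.1 (Matrix.eq_zero_of_vecMul_eq_zero hV this)

end RealCurves

section OnePair

variable {m s d : ℕ}

theorem linearIndependent_pair_of_coord {K : Type} [Field K] {p q : Fin (m + 2 + 1) → K}
    (hp : p 0 = 1) (hq : q 0 = 1) (h : p 1 ≠ q 1) : LinearIndependent K ![p, q] := by
  rw [LinearIndependent.pair_iff]
  intro x y hxy
  have h0 := congrFun hxy 0
  have h1 := congrFun hxy 1
  simp only [Pi.add_apply, Pi.smul_apply, smul_eq_mul, hp, hq, mul_one, Pi.zero_apply] at h0 h1
  have hx : x = -y := eq_neg_of_add_eq_zero_left h0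
  have hy : y * (q 1 - p 1) = 0 := by rw [← h1, hx]; ring
  have hy0 := (mul_eq_zero.1 hy).resolve_right (sub_ne_zero.2 h.symm)
  exact ⟨by rw [hx, hy0, neg_zero], hy0⟩

theorem separable_of_injective {b : ℕ} {p : Polynomial ℂ} (hp : p.Monic) (hdeg : p.natDegree = b)
    {t : Fin b → ℂ} (hinj : Function.Injective t) (ht : ∀ i, p.eval (t i) = 0) : p.Separable := by
  classical
  rw [← Polynomial.nodup_roots_iff_of_splits hp.ne_zero (IsAlgClosed.splits p),
    ← Multiset.toFinset_card_eq_card_iff_nodup]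
  refine le_antisymm (Multiset.toFinset_card_le _) ?_
  rw [← (IsAlgClosed.splits p).natDegree_eq_card_roots, hdeg]
  have h := Finset.card_le_card_of_injOn (s := (univ : Finset (Fin b))) (t := p.roots.toFinset) t
    (fun i _ => by
      simpa [Polynomial.mem_roots hp.ne_zero] using ht i) hinj.injOn
  simpa using h

/-- The decomposition attached to a recurrence polynomial with one pair of conjugate roots. -/
theorem exists_onePair (hd : 2 * (s + 2) - 1 ≤ d) {w : Fin (m + 2 + 1) → Fin (s + 2) → ℝ}
    (hw : (hankel (s + 2) (curveForm d w)).det ≠ 0) {ζ : ℂ} {τ : Fin s → ℝ}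
    (hζ : (recPoly (complexify w)).eval ζ = 0) (hζ' : star ζ ≠ ζ)
    (hinj : Function.Injective τ) (hτ : ∀ i, (recPoly w).eval (τ i) = 0) :
    HasOnePairDecomposition s (curveForm d w) ∧ IsSumOfPowers (s + 2 + d - 2) (curveForm d w) ∧
      (recPoly (complexify w)).Separable := by
  have hτreal : ∀ i, star (τ i : ℂ) = (τ i : ℂ) := fun i => Complex.conj_ofReal _
  set t : Fin (s + 2) → ℂ := Fin.cons ζ (Fin.cons (star ζ) fun i => (τ i : ℂ)) with htdef
  have htinj : Function.Injective t := by
    rw [htdef, Fin.cons_injective_iff, Fin.cons_injective_iff]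
    refine ⟨?_, ?_, fun i j h => hinj (Complex.ofReal_injective h)⟩
    · rintro ⟨i, hi⟩
      induction i using Fin.cases with
      | zero => exact hζ' (by simpa using hi)
      | succ i =>
        refine hζ' ?_
        rw [← hi, Fin.cons_succ, hτreal]
    · rintro ⟨i, hi⟩
      refine hζ' ?_
      have := congrArg star hi
      rw [hτreal, star_star] at this
      rw [← hi]
      exact this
  have ht : ∀ i, (recPoly (complexify w)).eval (t i) = 0 := by
    intro i
    induction i using Fin.cases with
    | zero => simpa [htdef] using hζ
    | succ i =>
      induction i using Fin.cases with
      | zero => simpa [htdef] using eval_recPoly_complexify_star hζ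
      | succ i =>
        simp only [htdef, Fin.cons_succ]
        rw [complexify_eq, recPoly_map, Polynomial.eval_map]
        have := Polynomial.eval₂_at_apply (p := recPoly w) Complex.ofRealHom (τ i)
        simpa [hτ] using this
  obtain ⟨c, hc⟩ := exists_coeff_of_roots htinj ht
  have hsum := curveForm_eq_sum (d := d) hc
  have hc0 : ∀ i, c i ≠ 0 :=
    (ne_zero_of_det_hankel_ne_zero hd (hsum ▸ det_hankel_complexify hw)).1
  -- The recurrence sequence is real and conjugation swaps the first two roots, so uniqueness of the
  -- coefficients makes the first two conjugate and the others real.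
  have hcc : c = Fin.cons (star (c 1)) (Fin.cons (star (c 0)) fun i => star (c i.succ.succ)) := by
    refine coeff_unique htinj fun j => ?_
    have h1 : star (recSeq (complexify w) j) = recSeq (complexify w) j := by
      rw [complexify_eq, recSeq_map]
      exact Complex.conj_ofReal _
    rw [← hc j, ← h1, hc j]
    simp only [Fin.sum_univ_succ, htdef, Fin.cons_zero, Fin.cons_succ, star_add, star_mul',
      star_pow, star_star, star_sum, hτreal]
    simp only [← add_assoc]
    congr 1
    rw [add_comm]
    rfl
  have hc1 : c 1 = star (c 0) := by
    have := congrFun hcc 1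
    exact this
  have hcr : ∀ i : Fin s, c i.succ.succ = ((c i.succ.succ).re : ℂ) := by
    intro i
    have : c i.succ.succ = star (c i.succ.succ) := congrFun hcc i.succ.succ
    exact (Complex.conj_eq_iff_re.1 this.symm).symm
  set q : Fin (m + 2 + 1) → ℂ := fun k => (curveCoord (complexify w) k).eval ζ with hq
  set r : Fin s → ℝ := fun i => (c i.succ.succ).re with hr
  set p : Fin s → Fin (m + 2 + 1) → ℝ := fun i k => (curveCoord w k).eval (τ i) with hp
  have hform : (fun e => ((curveForm d w e : ℝ) : ℂ)) = c 0 • powForm d q + star (c 0) • powForm d (star q) +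
      ∑ i, (r i : ℂ) • powForm d (fun k => (p i k : ℂ)) := by
    rw [← curveForm_complexify, hsum, Fin.sum_univ_succ, Fin.sum_univ_succ, ← add_assoc]
    congr 1
    · congr 1
      · have h1 : (fun k => (curveCoord (complexify w) k).eval (t (Fin.succ 0))) = star q := by
          funext k
          simp only [htdef, Fin.cons_succ, Fin.cons_zero, eval_curveCoord_complexify_star]
          rfl
        rw [h1, ← hc1]
        rfl
    · refine Finset.sum_congr rfl fun i _ => ?_
      rw [hcr i]
      congr 2
      funext k
      simp only [htdef, Fin.cons_succ, eval_curveCoord_complexify_ofReal, hp]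
  refine ⟨?_, ?_, separable_of_injective (recPoly_monic _) (natDegree_recPoly _) htinj ht⟩
  · refine ⟨c 0, q, r, p, hc0 0, ?_, ?_, ?_, ?_, ?_⟩
    · refine linearIndependent_pair_of_coord ?_ ?_ ?_
      · simp [hq, curveCoord_zero]
      · simp [hq, curveCoord_zero]
      · simpa [hq, curveCoord_one] using hζ'.symm
    · intro i hi
      refine hc0 i.succ.succ ?_
      rw [hcr i]
      exact_mod_cast hi
    · intro i hi
      have := congrFun hi 0
      simp [hp, curveCoord_zero] at this
    · intro i j hij
      refine linearIndependent_pair_of_coord ?_ ?_ ?_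
      · simp [hp, curveCoord_zero]
      · simp [hp, curveCoord_zero]
      · simpa [hp, curveCoord_one] using hinj.ne hij
    · have h1 : MvPolynomial.map Complex.ofRealHom (poly (curveForm d w)) =
          poly (fun e => ((curveForm d w e : ℝ) : ℂ)) := by
        simp [poly, map_sum, MvPolynomial.map_monomial]
      rw [h1, hform]
      have h2 := poly_sum_smul (univ : Finset (Fin (s + 2)))
        (Fin.cons (c 0) (Fin.cons (star (c 0)) fun i => (r i : ℂ)))
        (Fin.cons (powForm d q) (Fin.cons (powForm d (star q))
          fun i => powForm d (fun k => (p i k : ℂ))))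
      simp only [Fin.sum_univ_succ, Fin.cons_zero, Fin.cons_succ, poly_powForm, ← add_assoc] at h2
      exact h2
  -- The pair costs `d` real powers and the real roots cost `s`.
  · obtain ⟨r', a', h'⟩ := exists_real_decomposition_pair (m := m + 2) (d := d) (by omega) (c 0) q
    have h2 : curveForm d w =
        ∑ i : Fin d ⊕ Fin s, Sum.elim r' r i • powForm d (Sum.elim a' p i) := by
      have h3 : (fun e => ((curveForm d w e : ℝ) : ℂ)) = fun e => (((∑ i : Fin d ⊕ Fin s,
          Sum.elim r' r i • powForm d (Sum.elim a' p i) : Form ℝ (m + 2) d) e : ℝ) : ℂ) := by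
        rw [ofReal_sum_smul_powForm, hform, ← h', Fintype.sum_sum_type]
        rfl
      funext e
      exact_mod_cast congrFun h3 e
    rw [h2, isSumOfPowers_iff]
    have hcard : s + 2 + d - 2 = d + s := by omega
    rw [hcard]
    refine ⟨fun i => Sum.elim r' r (finSumFinEquiv.symm i),
      fun i => Sum.elim a' p (finSumFinEquiv.symm i), ?_⟩
    exact (Equiv.sum_comp finSumFinEquiv.symm fun i =>
      Sum.elim r' r i • powForm d (Sum.elim a' p i)).symm

end OnePair

end RealTypicalRank

/-! ### Perturbations, open conditions on parameters, and the two pieces. -/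

namespace RealTypicalRank

open Finset Filter Topology

variable {m b s d : ℕ}

section Perturbation

theorem fin_two_ne_zero (m : ℕ) : (2 : Fin (m + 2 + 1)) ≠ 0 := by
  have h : 2 % (m + 2 + 1) = 2 := Nat.mod_eq_of_lt (by omega)
  simp [Fin.ext_iff, h]

theorem fin_two_ne_one (m : ℕ) : (2 : Fin (m + 2 + 1)) ≠ 1 := by
  have h : 2 % (m + 2 + 1) = 2 := Nat.mod_eq_of_lt (by omega)
  simp [Fin.ext_iff, h]

theorem complexify_shiftParam (k₀ : Fin (m + 1)) (j₀ : ℕ) (w : Fin (m + 1) → Fin b → ℝ) (ε : ℝ) :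
    complexify (shiftParam k₀ j₀ w ε) = shiftParam k₀ j₀ (complexify w) (ε : ℂ) := by
  funext k j
  simp only [complexify, shiftParam]
  split_ifs <;> simp

theorem exists_shiftParam_mem (k₀ : Fin (m + 1)) (j₀ : ℕ) {B : Set (Fin (m + 1) → Fin b → ℝ)}
    (hB : IsOpen B) {w : Fin (m + 1) → Fin b → ℝ} (hw : w ∈ B) {F : Set ℂ} (hF : F.Finite) :
    ∃ ε : ℝ, shiftParam k₀ j₀ w ε ∈ B ∧ (ε : ℂ) ∉ F := by
  have hnhds : {ε : ℝ | shiftParam k₀ j₀ w ε ∈ B} ∈ 𝓝 (0 : ℝ) :=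
    (hB.preimage (continuous_shiftParam k₀ j₀ w)).mem_nhds (by
      rwa [Set.mem_preimage, shiftParam_zero])
  have hF' : (Complex.ofReal ⁻¹' F).Finite := hF.preimage Complex.ofReal_injective.injOn
  obtain ⟨ε, hε⟩ := ((infinite_of_mem_nhds (0 : ℝ) hnhds).sdiff hF').nonempty
  exact ⟨ε, hε.1, hε.2⟩

theorem recPoly_shiftParam_of_ne {R : Type} [CommRing R] {k₀ : Fin (m + 1)} (hk : 1 ≠ k₀) (j₀ : ℕ)
    (w : Fin (m + 1) → Fin b → R) (ε : R) : recPoly (shiftParam k₀ j₀ w ε) = recPoly w := by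
  simp [recPoly_eq, shiftParam, hk]

theorem curveCoord_shiftParam {R : Type} [CommRing R] (hb : 2 < b)
    (w : Fin (m + 2 + 1) → Fin b → R) (ε : R) :
    curveCoord (shiftParam 2 2 w ε) 2 = curveCoord w 2 + Polynomial.C ε * Polynomial.X ^ 2 := by
  have h0 : (2 : Fin (m + 2 + 1)) ≠ 0 := fin_two_ne_zero m
  have h1 : (2 : Fin (m + 2 + 1)) ≠ 1 := fin_two_ne_one m
  have h : ∑ j : Fin b, (Polynomial.C (if (j : ℕ) = 2 then ε else 0) * Polynomial.X ^ (j : ℕ)) =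
      Polynomial.C ε * Polynomial.X ^ 2 := by
    rw [Finset.sum_eq_single ⟨2, hb⟩]
    · simp
    · intro j _ hj
      have : (j : ℕ) ≠ 2 := fun h => hj (Fin.ext h)
      simp [this]
    · simp
  rw [curveCoord_of_ne _ h0 h1, curveCoord_of_ne _ h0 h1, ← h, ← Finset.sum_add_distrib]
  refine Finset.sum_congr rfl fun j _ => ?_
  simp only [shiftParam, true_and, Polynomial.C_add, add_mul]

theorem noThreeCollinear_of_le_two (hb : b ≤ 2) (w : Fin (m + 2 + 1) → Fin b → ℝ) :
    NoThreeCollinear w := by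
  classical
  intro x y z hx hy hz hxy hxz hyz
  exfalso
  have h0 : recPoly (complexify w) ≠ 0 := (recPoly_monic _).ne_zero
  have hsub : ({x, y, z} : Finset ℂ) ⊆ (recPoly (complexify w)).roots.toFinset := by
    intro u hu
    rw [Multiset.mem_toFinset, Polynomial.mem_roots h0]
    simp only [mem_insert, mem_singleton] at hu
    rcases hu with rfl | rfl | rfl <;> assumption
  have h1 := (Finset.card_le_card hsub).trans
    ((Multiset.toFinset_card_le _).trans (Polynomial.card_roots' _))
  rw [natDegree_recPoly, Finset.card_eq_three.2 ⟨x, y, z, hxy, hxz, hyz, rfl⟩] at h1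
  omega

/-- The constant coefficient of the recurrence is shifted to separate the roots, then the `t ^ 2`
coefficient of `h_2`, which leaves the roots unchanged. That coefficient exists only for `b > 2`;
otherwise there are no three roots. -/
theorem exists_separable_noThreeCollinear (hb : 0 < b)
    {B : Set (Fin (m + 2 + 1) → Fin b → ℝ)} (hB : IsOpen B) (hne : B.Nonempty) :
    ∃ w ∈ B, (recPoly (complexify w)).Separable ∧ NoThreeCollinear w := by
  obtain ⟨w, hw⟩ := hne
  obtain ⟨ε, hε, hεF⟩ := exists_shiftParam_mem 1 0 hB hw
    (finite_not_separable_sub_C (p := recPoly (complexify w)) (by rw [natDegree_recPoly]; omega))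
  have hsep : (recPoly (complexify (shiftParam 1 0 w ε))).Separable := by
    rw [complexify_shiftParam, recPoly_shiftParam hb]
    simpa using hεF
  set v := shiftParam 1 0 w ε
  rcases le_or_gt b 2 with hb2 | hb2
  · exact ⟨v, hε, hsep, noThreeCollinear_of_le_two hb2 v⟩
  set η := curveCoord (complexify v) 2
  have hfin : {z : ℂ | (recPoly (complexify v)).eval z = 0}.Finite := by
    refine (recPoly (complexify v)).roots.toFinset.finite_toSet.subset fun z hz => ?_
    simpa [(recPoly_monic (complexify v)).ne_zero] using hz
  -- For each triple of distinct roots, the quotient is the only shift that makes the three points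
  -- collinear.
  obtain ⟨δ, hδ, hδF⟩ := exists_shiftParam_mem 2 2 hB hε
    ((hfin.prod (hfin.prod hfin)).image fun p : ℂ × ℂ × ℂ =>
      ((p.2.1 - p.1) * (η.eval p.2.2 - η.eval p.1) - (p.2.2 - p.1) * (η.eval p.2.1 - η.eval p.1)) /
        ((p.2.2 - p.1) * (p.2.1 - p.1) * (p.2.1 - p.2.2)))
  have hpoly : recPoly (complexify (shiftParam 2 2 v δ)) = recPoly (complexify v) := by
    rw [complexify_shiftParam, recPoly_shiftParam_of_ne (fin_two_ne_one m).symm]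
  refine ⟨_, hδ, by rwa [hpoly], ?_⟩
  intro x y z hx hy hz hxy hxz hyz heq
  rw [hpoly] at hx hy hz
  refine hδF ⟨(x, y, z), ⟨hx, hy, hz⟩, ?_⟩
  rw [complexify_shiftParam, curveCoord_shiftParam hb2] at heq
  simp only [Polynomial.eval_add, Polynomial.eval_mul, Polynomial.eval_C, Polynomial.eval_pow,
    Polynomial.eval_X] at heq
  have h1 := sub_ne_zero.2 hxz.symm
  have h2 := sub_ne_zero.2 hxy.symm
  have h3 := sub_ne_zero.2 hyz
  simp only
  rw [div_eq_iff (mul_ne_zero (mul_ne_zero h1 h2) h3)]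
  linear_combination -heq

end Perturbation

section RealRoots

theorem exists_root_of_mul_neg {p : Polynomial ℝ} {x y : ℝ} (hxy : x < y)
    (h : p.eval x * p.eval y < 0) : ∃ z, x < z ∧ z < y ∧ p.eval z = 0 := by
  have hivt := intermediate_value_uIcc (a := x) (b := y) (f := fun t => p.eval t)
    p.continuous.continuousOn
  have h0 : (0 : ℝ) ∈ Set.uIcc (p.eval x) (p.eval y) := by
    rw [Set.mem_uIcc]
    rcases mul_neg_iff.1 h with h | h
    · exact Or.inr ⟨h.2.le, h.1.le⟩
    · exact Or.inl ⟨h.1.le, h.2.le⟩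
  obtain ⟨z, hz, hpz⟩ := hivt h0
  rw [Set.uIcc_of_le hxy.le] at hz
  simp only at hpz
  refine ⟨z, lt_of_le_of_ne hz.1 ?_, lt_of_le_of_ne hz.2 ?_, hpz⟩
  · rintro rfl
    simp [hpz] at h
  · rintro rfl
    simp [hpz] at h

/-- The polynomial changes sign around `0, …, s - 1`. -/
def SignChanges (s : ℕ) (p : Polynomial ℝ) : Prop :=
  ∀ i : Fin s, p.eval ((i : ℝ) - 1 / 2) * p.eval ((i : ℝ) + 1 / 2) < 0

theorem SignChanges.exists_roots {p : Polynomial ℝ} (hp : SignChanges s p) :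
    ∃ τ : Fin s → ℝ, Function.Injective τ ∧ ∀ i, p.eval (τ i) = 0 := by
  choose τ h1 h2 h3 using fun i : Fin s => exists_root_of_mul_neg (by linarith) (hp i)
  refine ⟨τ, fun i j hij => ?_, h3⟩
  have hi1 := h1 i
  have hi2 := h2 i
  have hj1 := h1 j
  have hj2 := h2 j
  rw [hij] at hi1 hi2
  have a1 : ((i : ℕ) : ℝ) < ((j : ℕ) : ℝ) + 1 := by linarith
  have a2 : ((j : ℕ) : ℝ) < ((i : ℕ) : ℝ) + 1 := by linarith
  have b1 : (i : ℕ) < j + 1 := by exact_mod_cast a1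
  have b2 : (j : ℕ) < i + 1 := by exact_mod_cast a2
  exact Fin.ext (by omega)

theorem signChanges_mul_prod {q : Polynomial ℝ} (hq : ∀ x, 0 < q.eval x) (s : ℕ) :
    SignChanges s (q * ∏ j : Fin s, (Polynomial.X - Polynomial.C ((j : ℕ) : ℝ))) := by
  intro i
  simp only [Polynomial.eval_mul, Polynomial.eval_prod, Polynomial.eval_sub, Polynomial.eval_X,
    Polynomial.eval_C]
  rw [mul_mul_mul_comm, ← Finset.prod_mul_distrib]
  refine mul_neg_of_pos_of_neg (mul_pos (hq _) (hq _)) ?_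
  rw [← Finset.mul_prod_erase _ _ (Finset.mem_univ i)]
  -- The factor of index `i` is `-1/4`; any other is `(i - j) ^ 2 - 1/4 > 0`.
  refine mul_neg_of_neg_of_pos (by ring_nf; norm_num) (Finset.prod_pos fun j hj => ?_)
  have hne : (i : ℕ) ≠ j := fun h => (Finset.mem_erase.1 hj).1 (Fin.ext h.symm)
  have h1 : (1 : ℝ) ≤ (((i : ℕ) : ℝ) - ((j : ℕ) : ℝ)) ^ 2 := by
    have : (1 : ℤ) ≤ (((i : ℕ) : ℤ) - ((j : ℕ) : ℤ)) ^ 2 := by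
      have h0 : (((i : ℕ) : ℤ) - ((j : ℕ) : ℤ)) ≠ 0 := by omega
      have := pow_pos (abs_pos.2 h0) 2
      rw [sq_abs] at this
      omega
    exact_mod_cast this
  nlinarith

theorem continuous_eval_recPoly (x : ℝ) :
    Continuous fun w : Fin (m + 1) → Fin b → ℝ => (recPoly w).eval x := by
  simp_rw [eval_recPoly]
  fun_prop

theorem eventually_signChanges {w₀ : Fin (m + 1) → Fin b → ℝ} (h : SignChanges s (recPoly w₀)) :
    ∀ᶠ w in 𝓝 w₀, SignChanges s (recPoly w) :=
  eventually_all.2 fun i =>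
    (((continuous_eval_recPoly _).mul (continuous_eval_recPoly _)).continuousAt).eventually_lt_const
      (h i)

/-- The parameter with recurrence polynomial `p`, with the initial values `0, …, 0, 1`, and whose
other coordinates are quadratic monomials. -/
noncomputable def paramOfPoly (m b : ℕ) (p : Polynomial ℝ) : Fin (m + 1) → Fin b → ℝ := fun k j =>
  if k = 0 then (if (j : ℕ) = b - 1 then 1 else 0)
  else if k = 1 then -p.coeff j else if (j : ℕ) = 2 then 1 else 0

theorem recPoly_paramOfPoly {p : Polynomial ℝ} (hp : p.Monic) (hdeg : p.natDegree = b) :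
    recPoly (paramOfPoly (m + 2) b p) = p := by
  rw [recPoly_eq]
  conv_rhs => rw [hp.as_sum, hdeg]
  rw [Finset.sum_range fun i => Polynomial.C (p.coeff i) * Polynomial.X ^ i]
  simp [paramOfPoly]

theorem det_hankel_paramOfPoly (hb : 0 < b) (hd : 2 * b - 1 ≤ d) (p : Polynomial ℝ) :
    (hankel b (curveForm d (paramOfPoly (m + 2) b p))).det ≠ 0 :=
  det_hankel_ne_zero_of_single hb hd fun j => by simp [paramOfPoly]

/-- Each real root is at distance at least 1 from `I`. Thus a value below 1 at `I` is an open
condition that forces a non-real root. -/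
theorem one_le_norm_eval_I {p : Polynomial ℂ} (hp : p.Monic)
    (h : ∀ z, p.eval z = 0 → star z = z) : 1 ≤ ‖p.eval Complex.I‖ := by
  have hsplit := (IsAlgClosed.splits p).eq_prod_roots_of_monic hp
  have hroots : ∀ z ∈ p.roots, star z = z := fun z hz =>
    h z (Polynomial.isRoot_of_mem_roots hz)
  rw [hsplit, Polynomial.eval_multiset_prod, Multiset.map_map]
  generalize p.roots = r at hroots
  induction r using Multiset.induction_on with
  | empty => simp
  | cons z r ih =>
    rw [Multiset.map_cons, Multiset.prod_cons, norm_mul]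
    refine one_le_mul_of_one_le_of_one_le ?_ (ih fun x hx => hroots x (Multiset.mem_cons_of_mem hx))
    have hz : z.im = 0 := Complex.conj_eq_iff_im.1 (hroots z (Multiset.mem_cons_self _ _))
    have := Complex.abs_im_le_norm (Complex.I - z)
    simpa [hz] using this

theorem continuous_norm_eval_I :
    Continuous fun w : Fin (m + 1) → Fin b → ℝ => ‖(recPoly (complexify w)).eval Complex.I‖ := by
  simp_rw [eval_recPoly]
  unfold complexify
  fun_prop

end RealRoots

section DividedDifference

/-- The second divided difference of `t ↦ t ^ j`. -/
noncomputable def divDiff (j : ℕ) (x y z : ℂ) : ℂ :=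
  ∑ a ∈ range j, (∑ i ∈ range a, z ^ i * y ^ (a - 1 - i)) * x ^ (j - 1 - a)

/-- Collinearity of three curve points is the vanishing of a second divided difference, which as a
polynomial also makes sense when points coincide. No continuous choice of roots is then needed. -/
theorem divDiff_mul (j : ℕ) (x y z : ℂ) :
    (z - x) * (y - x) * (z - y) * divDiff j x y z =
      (y - x) * (z ^ j - x ^ j) - (z - x) * (y ^ j - x ^ j) := by
  have h : divDiff j x y z * (z - y) =
      (∑ a ∈ range j, z ^ a * x ^ (j - 1 - a)) - ∑ a ∈ range j, y ^ a * x ^ (j - 1 - a) := by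
    rw [divDiff, Finset.sum_mul, ← Finset.sum_sub_distrib]
    refine Finset.sum_congr rfl fun a _ => ?_
    rw [mul_right_comm, geom_sum₂_mul, sub_mul]
  rw [← geom_sum₂_mul z x j, ← geom_sum₂_mul y x j]
  linear_combination (z - x) * (y - x) * h

/-- The second divided difference of the third coordinate of the curve. -/
noncomputable def curveDivDiff (w : Fin (m + 2 + 1) → Fin b → ℝ) (p : ℂ × ℂ × ℂ) : ℂ :=
  ∑ j : Fin b, (w 2 j : ℂ) * divDiff j p.1 p.2.1 p.2.2

theorem curveDivDiff_mul (w : Fin (m + 2 + 1) → Fin b → ℝ) (x y z : ℂ) :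
    (z - x) * (y - x) * (z - y) * curveDivDiff w (x, y, z) =
      (y - x) * ((curveCoord (complexify w) 2).eval z - (curveCoord (complexify w) 2).eval x) -
        (z - x) * ((curveCoord (complexify w) 2).eval y - (curveCoord (complexify w) 2).eval x) := by
  have h0 : (2 : Fin (m + 2 + 1)) ≠ 0 := fin_two_ne_zero m
  have h1 : (2 : Fin (m + 2 + 1)) ≠ 1 := fin_two_ne_one m
  rw [curveCoord_of_ne _ h0 h1]
  simp only [Polynomial.eval_finsetSum, Polynomial.eval_mul, Polynomial.eval_C,
    Polynomial.eval_pow, Polynomial.eval_X, curveDivDiff, Finset.mul_sum,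
    ← Finset.sum_sub_distrib]
  refine Finset.sum_congr rfl fun j _ => ?_
  have := divDiff_mul j x y z
  simp only [complexify]
  linear_combination (w 2 j : ℂ) * this

theorem continuous_curveDivDiff :
    Continuous fun q : (Fin (m + 2 + 1) → Fin b → ℝ) × (ℂ × ℂ × ℂ) => curveDivDiff q.1 q.2 := by
  unfold curveDivDiff divDiff
  fun_prop

theorem norm_le_of_root {w : Fin (m + 1) → Fin b → ℝ} {G : ℝ} (hG : ‖w‖ ≤ G) {z : ℂ}
    (hz : (recPoly (complexify w)).eval z = 0) : ‖z‖ ≤ max 1 (b * G) := by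
  rcases le_or_gt ‖z‖ 1 with h | h
  · exact h.trans (le_max_left _ _)
  refine le_trans ?_ (le_max_right _ _)
  rw [eval_recPoly, sub_eq_zero] at hz
  have hb : b ≠ 0 := by
    rintro rfl
    simp at hz
  obtain ⟨k, rfl⟩ := Nat.exists_eq_succ_of_ne_zero hb
  have hbound : ‖z‖ ^ (k + 1) ≤ ∑ _j : Fin (k + 1), G * ‖z‖ ^ k := by
    rw [← norm_pow, hz]
    refine (norm_sum_le _ _).trans (Finset.sum_le_sum fun j _ => ?_)
    rw [norm_mul, norm_pow]
    refine mul_le_mul ?_ (pow_le_pow_right₀ h.le (by omega)) (by positivity)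
      ((norm_nonneg _).trans hG)
    rw [complexify, Complex.norm_real]
    exact ((norm_le_pi_norm (w 1) j).trans (norm_le_pi_norm w 1)).trans hG
  rw [Finset.sum_const, Finset.card_univ, Fintype.card_fin, nsmul_eq_mul, pow_succ', ← mul_assoc] at hbound
  exact le_of_mul_le_mul_right hbound (by positivity)

/-- For `b > 2` the base parameter has `h_2 = t ^ 2`, with divided difference constantly 1. Roots of
nearby parameters stay in a fixed ball, so by compactness the divided difference stays nonzero
there. -/
theorem eventually_noThreeCollinear (p : Polynomial ℝ) :
    ∀ᶠ w in 𝓝 (paramOfPoly (m + 2) b p), NoThreeCollinear w := by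
  rcases le_or_gt b 2 with hb | hb
  · exact Eventually.of_forall (noThreeCollinear_of_le_two hb)
  set w₀ := paramOfPoly (m + 2) b p with hw₀
  have h0 : (2 : Fin (m + 2 + 1)) ≠ 0 := fin_two_ne_zero m
  have h1 : (2 : Fin (m + 2 + 1)) ≠ 1 := fin_two_ne_one m
  have hone : ∀ q, curveDivDiff w₀ q = 1 := by
    intro q
    rw [curveDivDiff, Finset.sum_eq_single ⟨2, hb⟩]
    · simp [hw₀, paramOfPoly, h0, h1, divDiff, Finset.sum_range_succ]
    · intro j _ hj
      have : (j : ℕ) ≠ 2 := fun h => hj (Fin.ext h)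
      simp [hw₀, paramOfPoly, h0, h1, this]
    · simp
  set R : ℝ := max 1 (b * (‖w₀‖ + 1))
  have hK : IsCompact ((Metric.closedBall (0 : ℂ) R) ×ˢ
      (Metric.closedBall (0 : ℂ) R ×ˢ Metric.closedBall (0 : ℂ) R)) :=
    (isCompact_closedBall _ _).prod ((isCompact_closedBall _ _).prod (isCompact_closedBall _ _))
  have hev : ∀ᶠ w in 𝓝 w₀, ∀ q ∈ (Metric.closedBall (0 : ℂ) R) ×ˢ
      (Metric.closedBall (0 : ℂ) R ×ˢ Metric.closedBall (0 : ℂ) R), curveDivDiff w q ≠ 0 := by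
    refine hK.eventually_forall_of_forall_eventually fun q _ => ?_
    refine (continuous_curveDivDiff.continuousAt (x := (w₀, q))).eventually_ne ?_
    simp [hone]
  have hnorm : ∀ᶠ w in 𝓝 w₀, ‖w‖ ≤ ‖w₀‖ + 1 :=
    (continuous_norm.continuousAt.eventually_lt_const (lt_add_one _)).mono fun _ h => h.le
  filter_upwards [hev, hnorm] with w hw hwn
  intro x y z hx hy hz hxy hxz hyz heq
  have hmem : ∀ u, (recPoly (complexify w)).eval u = 0 → u ∈ Metric.closedBall (0 : ℂ) R := by
    intro u hu
    rw [mem_closedBall_zero_iff]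
    exact norm_le_of_root hwn hu
  refine hw (x, y, z) ⟨hmem x hx, hmem y hy, hmem z hz⟩ ?_
  have := curveDivDiff_mul w x y z
  rw [heq, sub_self] at this
  exact (mul_eq_zero.1 this).resolve_left (mul_ne_zero (mul_ne_zero (sub_ne_zero.2 hxz.symm)
    (sub_ne_zero.2 hxy.symm)) (sub_ne_zero.2 hyz.symm))

end DividedDifference

section Pieces

theorem exists_isTopPiece_real (hb : 0 < b) (hd : 2 * b - 1 ≤ d) :
    ∃ U : Set (Form ℝ (m + 2) d), IsTopPiece (m + 2) d b U ∧ ∀ f ∈ U, HasRank f b := by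
  set p : Polynomial ℝ := 1 * ∏ j : Fin b, (Polynomial.X - Polynomial.C ((j : ℕ) : ℝ)) with hp
  have hmonic : p.Monic := by
    rw [hp, one_mul]
    exact Polynomial.monic_prod_of_monic _ _ fun j _ => Polynomial.monic_X_sub_C _
  have hdeg : p.natDegree = b := by
    rw [hp, one_mul, Polynomial.natDegree_prod_of_monic _ _ fun j _ => Polynomial.monic_X_sub_C _]
    simp only [Polynomial.natDegree_X_sub_C]
    simp
  have hsign : SignChanges b (recPoly (paramOfPoly (m + 2) b p)) := by
    rw [recPoly_paramOfPoly hmonic hdeg]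
    exact signChanges_mul_prod (by simp) b
  obtain ⟨U, hU, hUf⟩ := exists_isTopPiece hb hd (det_hankel_paramOfPoly hb hd p)
    (eventually_signChanges hsign)
  refine ⟨U, hU, fun f hf => ?_⟩
  obtain ⟨w, rfl, hw, hdet⟩ := hUf f hf
  obtain ⟨τ, hinj, hτ⟩ := hw.exists_roots
  exact ⟨isSumOfPowers_of_real_roots hinj hτ, fun t ht => le_of_isSumOfPowers hd hdet ht⟩

/-- The base polynomial is `(X² + 1) X (X - 1) ⋯ (X - (s - 1))`. Sign changes keep `s` real roots,
smallness at `I` keeps a non-real one, and with its conjugate these are all `s + 2` roots. -/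
theorem exists_isTopPiece_onePair (hd : 2 * (s + 2) - 1 ≤ d) :
    ∃ U : Set (Form ℝ (m + 2) d), IsTopPiece (m + 2) d (s + 2) U ∧
      ∀ f ∈ U, HasRank f (s + 2 + d - 2) ∧ HasOnePairDecomposition s f := by
  set q : Polynomial ℝ := Polynomial.X ^ 2 + 1 with hq
  have hqm : q.Monic := Polynomial.monic_X_pow_add_C 1 two_ne_zero
  have hqd : q.natDegree = 2 := Polynomial.natDegree_X_pow_add_C (r := (1 : ℝ))
  set p : Polynomial ℝ := q * ∏ j : Fin s, (Polynomial.X - Polynomial.C ((j : ℕ) : ℝ)) with hp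
  have hprod : (∏ j : Fin s, (Polynomial.X - Polynomial.C ((j : ℕ) : ℝ))).Monic :=
    Polynomial.monic_prod_of_monic _ _ fun j _ => Polynomial.monic_X_sub_C _
  have hmonic : p.Monic := hqm.mul hprod
  have hdeg : p.natDegree = s + 2 := by
    rw [hp, hqm.natDegree_mul hprod, hqd,
      Polynomial.natDegree_prod_of_monic _ _ fun j _ => Polynomial.monic_X_sub_C _]
    simp only [Polynomial.natDegree_X_sub_C]
    simp [add_comm]
  have hsign : SignChanges s (recPoly (paramOfPoly (m + 2) (s + 2) p)) := by
    rw [recPoly_paramOfPoly hmonic hdeg]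
    refine signChanges_mul_prod (fun x => ?_) s
    simp only [hq, Polynomial.eval_add, Polynomial.eval_pow, Polynomial.eval_X, Polynomial.eval_one]
    positivity
  have hI : ‖(recPoly (complexify (paramOfPoly (m + 2) (s + 2) p))).eval Complex.I‖ < 1 := by
    rw [complexify_eq, recPoly_map, recPoly_paramOfPoly hmonic hdeg, hp, Polynomial.map_mul,
      Polynomial.eval_mul]
    simp [hq]
  obtain ⟨U, hU, hUf⟩ := exists_isTopPiece (by omega) hd (det_hankel_paramOfPoly (by omega) hd p)
    ((eventually_signChanges hsign).and
      ((continuous_norm_eval_I.continuousAt.eventually_lt_const hI).and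
        (eventually_noThreeCollinear p)))
  refine ⟨U, hU, fun f hf => ?_⟩
  obtain ⟨w, rfl, ⟨hw, hwI, hcol⟩, hdet⟩ := hUf f hf
  obtain ⟨τ, hinj, hτ⟩ := hw.exists_roots
  obtain ⟨ζ, hζ, hζ'⟩ : ∃ ζ, (recPoly (complexify w)).eval ζ = 0 ∧ star ζ ≠ ζ := by
    by_contra! hcon
    exact absurd (one_le_norm_eval_I (recPoly_monic _) hcon) (not_le.2 hwI)
  obtain ⟨hdec, hsum, hsep⟩ := exists_onePair hd hdet hζ hζ' hinj hτ
  exact ⟨⟨hsum, fun t ht =>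
    le_of_isSumOfPowers_curveForm (by omega) hd hdet hsep hcol hζ hζ' ht⟩, hdec⟩

theorem IsTypicalRank.le (hb : 0 < b) (hd : 2 * b - 1 ≤ d) {g : ℕ}
    (hg : IsTypicalRank (m + 2) d b g) : b ≤ g := by
  obtain ⟨U, hU, hrank⟩ := hg
  obtain ⟨B, -, ⟨w, hw⟩, hB⟩ := hU.exists_isOpen hb hd
  exact le_of_isSumOfPowers hd (hB w hw).1 (hrank _ (hB w hw).2).1

/-- At a generic parameter of the piece, either all roots are real and the rank is at most `b`, or a
non-real root forces the lower bound. -/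
theorem IsTypicalRank.le_of_lt (hb : 2 ≤ b) (hd : 2 * b - 1 ≤ d) {g : ℕ}
    (hg : IsTypicalRank (m + 2) d b g) (hlt : b < g) : b + d - 2 ≤ g := by
  obtain ⟨U, hU, hrank⟩ := hg
  obtain ⟨B, hBo, hBne, hB⟩ := hU.exists_isOpen (by omega) hd
  obtain ⟨w, hw, hsep, hcol⟩ := exists_separable_noThreeCollinear (by omega) hBo hBne
  have hg := hrank _ (hB w hw).2
  by_cases hreal : ∀ ζ, (recPoly (complexify w)).eval ζ = 0 → star ζ = ζ
  · exfalso
    obtain ⟨t, hinj, ht, -⟩ := exists_roots_of_separable hsep (natDegree_recPoly _)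
    have hre : ∀ i, ((t i).re : ℂ) = t i := fun i => Complex.conj_eq_iff_re.1 (hreal _ (ht i))
    have hsum : IsSumOfPowers b (curveForm d w) := by
      refine isSumOfPowers_of_real_roots (τ := fun i => (t i).re) (fun i j hij => hinj ?_)
        fun i => ?_
      · rw [← hre i, ← hre j]
        exact congrArg _ hij
      · have h1 := ht i
        rw [← hre i, complexify_eq, recPoly_map, Polynomial.eval_map] at h1
        have h2 := Polynomial.eval₂_at_apply (p := recPoly w) Complex.ofRealHom (t i).re
        simp only [Complex.ofRealHom_eq_coe] at h2
        rw [h2] at h1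
        exact_mod_cast h1
    exact absurd (hg.2 hsum) (not_le.2 hlt)
  · push Not at hreal
    obtain ⟨ζ, hζ, hζ'⟩ := hreal
    exact le_of_isSumOfPowers_curveForm hb hd (hB w hw).1 hsep hcol hζ hζ' hg.1

end Pieces

end RealTypicalRank

theorem mainTheorem9 (m b d : ℕ) (hm : 2 ≤ m) (hb : 2 ≤ b) (hd : 2 * b - 1 ≤ d) :
    IsLeast {g : ℕ | RealTypicalRank.IsTypicalRank m d b g} b ∧
    IsLeast {g : ℕ | RealTypicalRank.IsTypicalRank m d b g ∧ b < g} (b + d - 2) ∧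
    ∃ U : Set (RealTypicalRank.Form ℝ m d), RealTypicalRank.IsTopPiece m d b U ∧
      ∀ f ∈ U, RealTypicalRank.HasRank f (b + d - 2) ∧
        RealTypicalRank.HasOnePairDecomposition (b - 2) f := by
  obtain ⟨m, rfl⟩ : ∃ n, m = n + 2 := ⟨m - 2, by omega⟩
  obtain ⟨s, rfl⟩ : ∃ s, b = s + 2 := ⟨b - 2, by omega⟩
  obtain ⟨U, hU, hUf⟩ := RealTypicalRank.exists_isTopPiece_onePair (m := m) hd
  refine ⟨⟨RealTypicalRank.exists_isTopPiece_real (by omega) hd,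
    fun g hg => RealTypicalRank.IsTypicalRank.le (by omega) hd hg⟩,
    ⟨⟨⟨U, hU, fun f hf => (hUf f hf).1⟩, by omega⟩,
      fun g hg => RealTypicalRank.IsTypicalRank.le_of_lt hb hd hg.1 hg.2⟩, U, hU, hUf⟩
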